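/- Let $KS_0$ be the equilateral triangle of side length $1$ with base $I=[0,1]$, and let $KS_{n+1}$ be obtained from $KS_n$ by replacing the middle third of every side by the other two sides of the outward equilateral triangle erected on it. Let $\Omega(KS_n)$ be the polygonal billiard table bounded by $KS_n$; its sides have length $3^{-n}$. For $x_0^0\in I$, a point $x_n^0\in KS_n$ is compatible with $x_0^0$ (in the direction $\pi/3$) if the direction $\pi/3$ is inward pointing at $x_n^0$, the point $x_0^0$ lies on the ray from $x_n^0$ in the direction $\pi/3$, and the part of this ray strictly between $x_n^0$ and $x_0^0$ lies inside $\Omega(KS_n)$ and contains no point of $KS_n$; all directions are measured in one fixed coordinate system. Let $\mathscr O_n(x_n^0,\pi/3)$ be the orbit of the billiard map of $\Omega(KS_n)$ with initial condition $(x_n^0,\pi/3)$, that is, the ordered sequence of its collision points together with the directions after reflection. Ternary digits $0,1,2$ are written $l,c,r$. **Theorem.** Let $x_0^0\in I$ have a ternary expansion with finitely many $c$'s, infinitely many $l$'s and infinitely many $r$'s, and let $N\ge 0$ be the least number of left shifts after which the expansion contains no $c$. Then: 1. There is exactly one sequence $(x_n^0)_{n\ge 0}$ that starts at $x_0^0$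 and all of whose terms are compatible with $x_0^0$, and for every $n\ge0$ the orbit $\mathscr O_n(x_n^0,\pi/3)$ is periodic (it closes up and never meets a vertex of $KS_n$). 2. For every $n\ge N$, $\mathscr O_n(x_n^0,\pi/3)=\mathscr O_N(x_N^0,\pi/3)$. 3. $N$ is the exact level of stabilization: for every $m<N$, $\mathscr O_m(x_m^0,\pi/3)\ne\mathscr O_N(x_N^0,\pi/3)$; even the sets of basepoints of these two orbits differ. 4. For every $n\ge N$, in particular for $n=N$, the point $x_n^0$ lies on a side of $KS_n$ relative to which its ternary expansion is the $n$-th left shift of the expansion of $x_0^0$. Here each side is identified with $[0,1]$ by an affine map, oriented counterclockwise along $KS_n$ (so that the base $I$ of $KS_0$ keeps its usual orientation). -/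

import Mathlib

open scoped Real

noncomputable section

namespace KochBilliard

/-- A directed segment of the plane, given by its initial point and its end point. -/
abbrev Side : Type := ℂ × ℂ

/-- The point at one third of a directed segment. -/
def Side.left (s : Side) : ℂ := s.1 + (1 / 3 : ℝ) • (s.2 - s.1)

/-- The point at two thirds of a directed segment. -/
def Side.right (s : Side) : ℂ := s.1 + (2 / 3 : ℝ) • (s.2 - s.1)

/-- The third vertex of the equilateral triangle erected on the middle third of a directed segment,
to the right of the segment. Polygons are traversed counterclockwise, so this is outside. -/
def Side.apex (s : Side) : ℂ :=
  s.left + Complex.exp (-(π / 3 : ℝ) * Complex.I) * (s.right - s.left)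

/-- The closed triangle (cell) that is glued to the middle third of a side. -/
def Side.cell (s : Side) : Set ℂ := convexHull ℝ {s.left, s.apex, s.right}

/-- The four sides by which the Koch construction replaces a side. -/
def Side.subdivide (s : Side) : List Side :=
  [(s.1, s.left), (s.left, s.apex), (s.apex, s.right), (s.right, s.2)]

/-- The top vertex of the unit equilateral triangle with base `[0, 1]`. -/
def top : ℂ := Complex.exp ((π / 3 : ℝ) * Complex.I)

/-- The `3 * 4 ^ n` sides of the `n`th Koch snowflake prefractal, directed counterclockwise.
Level `0` is the unit equilateral triangle whose base is the unit interval. -/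
def sides : ℕ → List Side
  | 0 => [(0, 1), (1, top), (top, 0)]
  | n + 1 => (sides n).flatMap Side.subdivide

/-- The polygonal curve `KS_n`. -/
def KS (n : ℕ) : Set ℂ := {z | ∃ s ∈ sides n, z ∈ segment ℝ s.1 s.2}

/-- The billiard table `Ω(KS_n)`, the closed region bounded by `KS_n`: start with the triangle and
glue at each step a cell to the middle third of every side. -/
def table : ℕ → Set ℂ
  | 0 => convexHull ℝ {0, 1, top}
  | n + 1 => table n ∪ {z | ∃ s ∈ sides n, z ∈ s.cell}

/-- The open region enclosed by `KS_n`. -/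
def inside (n : ℕ) : Set ℂ := table n \ KS n

/-- A point of the phase space: a basepoint and a direction (a unit vector, measured in the fixed
coordinate system). On the boundary the class of a direction modulo reflection in the side is
represented by the inward pointing direction. -/
abbrev Phase : Type := ℂ × ℂ

/-- The ball leaves the basepoint of `p` in the direction of `p`, moves inside the table until its
first collision with `KS_n`, which happens at the basepoint of `q`, in the relative interior of a
side (not at a vertex), and the direction of `q` is the reflected direction. -/
def Collision (n : ℕ) (p q : Phase) : Prop :=
  (∃ t : ℝ, 0 < t ∧ q.1 = p.1 + t • p.2 ∧ ∀ r ∈ Set.Ioo 0 t, p.1 + r • p.2 ∈ inside n) ∧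
  ∃ s ∈ sides n, q.1 ∈ openSegment ℝ s.1 s.2 ∧
    q.2 = (Submodule.span ℝ {s.2 - s.1}).reflection p.2

open Classical in
/-- The billiard map `f_n` of `Ω(KS_n)`; it is undefined (`none`) when the ball runs into a vertex
(or is not pointing into the table). -/
def billiardMap (n : ℕ) (p : Phase) : Option Phase :=
  if h : ∃ q, Collision n p q then some h.choose else none

/-- The orbit of the initial condition `p`: the dynamically ordered sequence of the iterates
`f_n^k p`, `k = 0, 1, 2, …`. -/
def orbit (n : ℕ) (p : Phase) : ℕ → Option Phase
  | 0 => some p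
  | k + 1 => (orbit n p k).bind (billiardMap n)

/-- The orbit of `p` is periodic: it closes up without ever meeting a vertex. -/
def IsPeriodic (n : ℕ) (p : Phase) : Prop := ∃ T : ℕ, 0 < T ∧ orbit n p T = some p

/-- The footprint of the orbit of `p`: the set of its basepoints. -/
def footprint (n : ℕ) (p : Phase) : Set ℂ := {z | ∃ (k : ℕ) (v : ℂ), orbit n p k = some (z, v)}

/-- The direction `v` is inward pointing at the boundary point `x` of `Ω(KS_n)`. -/
def Inward (n : ℕ) (x v : ℂ) : Prop := ∃ ε : ℝ, 0 < ε ∧ ∀ r ∈ Set.Ioo 0 ε, x + r • v ∈ inside n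

/-- The boundary point `x` of `Ω(KS_n)` is compatible with `x₀` in the direction `v`: the direction
is inward pointing at `x`, the ray from `x` in this direction passes through `x₀`, and the segment
between `x` and `x₀` lies inside the table, without points of `KS_n`. -/
def Compatible (n : ℕ) (v x₀ x : ℂ) : Prop :=
  x ∈ KS n ∧ Inward n x v ∧
    ∃ t : ℝ, 0 ≤ t ∧ x₀ = x + t • v ∧ ∀ r ∈ Set.Ioo 0 t, x + r • v ∈ inside n

/-- `x` is a compatible sequence of initial basepoints, in the direction `v`, starting at `x₀`. -/
def IsCompatibleSeq (v x₀ : ℂ) (x : ℕ → ℂ) : Prop := x 0 = x₀ ∧ ∀ n, Compatible n v x₀ (x n)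

/-- The direction `π / 3`. -/
def dir : ℂ := Complex.exp ((π / 3 : ℝ) * Complex.I)

/-- The left shift of a sequence of ternary characters `0 = l`, `1 = c`, `2 = r`. -/
def leftShift (d : ℕ → Fin 3) : ℕ → Fin 3 := fun i => d (i + 1)

end KochBilliard

end

open KochBilliard

/-! The sides of `KS n` are edges of the triangular lattice of mesh `3⁻ⁿ`, and the table is a union
of lattice triangles. Along a ray whose direction is a multiple of `π / 3` the transversal lattice
coordinate is constant. Hence a ray that starts at ratio `t` of a lattice edge cuts every lattice
edge not parallel to it at ratio `t` or `1 - t`. If `0 < t < 1`, no vertex is ever hit and only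
finitely many phases are reachable. The billiard map is injective on them, so the orbit is periodic
(`LatticePhase.exists_collision`, `LatticePhase.isPeriodic`).

Passing to the next level removes only the middle thirds of the sides. If the expansion of `t` has
no `c`, neither has that of `1 - t`, so every collision point stays on a side parallel to the old
one. The flights stay inside because the open regions increase. Thus the whole orbit survives at all
later levels (`orbit_persist`). A digit `c`, in contrast, puts the basepoint under a new cell. The
point becomes interior, and the backward ray crosses the cell and ends on one of its two free sides,
at the ratio given by the shifted expansion (`compatiblePoint_succ_of_eq_one`). So `x n` has the
ratio with the `n`-th shifted digits. For `m < N` the point `x m` is swallowed by the interior at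
some level at most `N`, so it is off the footprint at level `N`.

The geometric input is that `inside n`, defined as the table minus the curve, is the interior of the
table (`inside_eq_interior`). It rests on a combinatorial description of the curve: a side is an
edge with a filled triangle on its left and an empty one on its right. This description passes from
one level to the next by a computation with residues modulo `3` (`isBdEdge_grow`), which replaces
any argument about self-intersections. -/

noncomputable section

namespace KochBilliard

open Filter Topology

/-! ### Lattice triangles and their boundary edges -/

/-- The integer pair `(u, v)` represents a unit `u + v ω` of the Eisenstein lattice. -/
def IsUnitPair (u v : ℤ) : Prop := u * u + u * v + v * v = 1

theorem isUnitPair_iff {u v : ℤ} : IsUnitPair u v ↔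
    (u = 1 ∧ v = 0) ∨ (u = 0 ∧ v = 1) ∨ (u = -1 ∧ v = 1) ∨ (u = -1 ∧ v = 0) ∨
      (u = 0 ∧ v = -1) ∨ (u = 1 ∧ v = -1) := by
  unfold IsUnitPair
  constructor
  · intro h
    have h1 : -1 ≤ u := by nlinarith [sq_nonneg (u + 2 * v)]
    have h2 : u ≤ 1 := by nlinarith [sq_nonneg (u + 2 * v)]
    have h3 : -1 ≤ v := by nlinarith [sq_nonneg (2 * u + v)]
    have h4 : v ≤ 1 := by nlinarith [sq_nonneg (2 * u + v)]
    interval_cases u <;> interval_cases v <;> simp_all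
  · rintro (⟨rfl, rfl⟩ | ⟨rfl, rfl⟩ | ⟨rfl, rfl⟩ | ⟨rfl, rfl⟩ | ⟨rfl, rfl⟩ | ⟨rfl, rfl⟩) <;> norm_num

theorem IsUnitPair.neg {u v : ℤ} (h : IsUnitPair u v) : IsUnitPair (-u) (-v) := by
  unfold IsUnitPair at *; linarith

/-- Multiplication by `ω`. -/
theorem IsUnitPair.rotate {u v : ℤ} (h : IsUnitPair u v) : IsUnitPair (-v) (u + v) := by
  unfold IsUnitPair at *; linarith

/-- Multiplication by `ω⁻¹`. -/
theorem IsUnitPair.rotate_inv {u v : ℤ} (h : IsUnitPair u v) : IsUnitPair (u + v) (-u) := by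
  unfold IsUnitPair at *; linarith

/-- The smallest first coordinate of the lattice triangle to the left of an edge. -/
def triX (a u v : ℤ) : ℤ := a + min 0 (min u (-v))

/-- The smallest second coordinate of the lattice triangle to the left of an edge. -/
def triY (b u v : ℤ) : ℤ := b + min 0 (min v (u + v))

/-- The smallest coordinate sum of the lattice triangle to the left of an edge. -/
def triZ (a b u v : ℤ) : ℤ := a + b + min 0 (min (u + v) u)

/-- The lattice triangle to the left of the edge from `(a, b)` to `(a + u, b + v)` satisfies `P`.
A lattice triangle is given by the lower bounds of its two coordinates and of their sum. -/
def LeftOf (P : ℤ → ℤ → ℤ → Prop) (a b u v : ℤ) : Prop := P (triX a u v) (triY b u v) (triZ a b u v)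

/-- The directed edge from `(a, b)` to `(a + u, b + v)` has on its left a triangle with `P` and
on its right a triangle without `P`. -/
def IsBdEdge (P : ℤ → ℤ → ℤ → Prop) (a b u v : ℤ) : Prop :=
  IsUnitPair u v ∧ LeftOf P a b u v ∧ ¬ LeftOf P (a + u) (b + v) (-u) (-v)

/-- Refine a set of lattice triangles by the factor `3` and glue a cell to the middle third of every
boundary edge. -/
def grow (P : ℤ → ℤ → ℤ → Prop) (i j k : ℤ) : Prop :=
  (k = i + j ∨ k = i + j + 1) ∧ (P (i / 3) (j / 3) (k / 3) ∨
    ∃ a b u v, IsBdEdge P a b u v ∧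
      LeftOf (fun i' j' k' => i = i' ∧ j = j' ∧ k = k') (3 * a + u) (3 * b + v) (u + v) (-u))

/-- The lattice triangles of side `3⁻ⁿ` which make up the `n`th table. -/
def Filled : ℕ → ℤ → ℤ → ℤ → Prop
  | 0 => fun i j k => i = 0 ∧ j = 0 ∧ k = 0
  | n + 1 => grow (Filled n)

theorem Filled.valid {n : ℕ} {i j k : ℤ} (h : Filled n i j k) : k = i + j ∨ k = i + j + 1 := by
  cases n with
  | zero => obtain ⟨rfl, rfl, rfl⟩ := h; simp
  | succ n => exact h.1

theorem triangle_valid {a b u v : ℤ} (h : IsUnitPair u v) :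
    triZ a b u v = triX a u v + triY b u v ∨ triZ a b u v = triX a u v + triY b u v + 1 := by
  unfold triX triY triZ
  rcases isUnitPair_iff.1 h with
    ⟨rfl, rfl⟩ | ⟨rfl, rfl⟩ | ⟨rfl, rfl⟩ | ⟨rfl, rfl⟩ | ⟨rfl, rfl⟩ | ⟨rfl, rfl⟩ <;> omega

/-- The triangle to the left of a refined edge lies in the triangle to the left of the edge. -/
theorem triangle_parent {a b u v r : ℤ} (h : IsUnitPair u v) (hr : 0 ≤ r) (hr' : r ≤ 2) :
    triX (3 * a + r * u) u v / 3 = triX a u v ∧ triY (3 * b + r * v) u v / 3 = triY b u v ∧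
      triZ (3 * a + r * u) (3 * b + r * v) u v / 3 = triZ a b u v := by
  unfold triX triY triZ
  rcases isUnitPair_iff.1 h with
    ⟨rfl, rfl⟩ | ⟨rfl, rfl⟩ | ⟨rfl, rfl⟩ | ⟨rfl, rfl⟩ | ⟨rfl, rfl⟩ | ⟨rfl, rfl⟩ <;> omega

theorem triangle_reverse_parent {a b u v r : ℤ} (h : IsUnitPair u v) (hr : 0 ≤ r) (hr' : r ≤ 2) :
    triX (3 * a + r * u + u) (-u) (-v) / 3 = triX (a + u) (-u) (-v) ∧
    triY (3 * b + r * v + v) (-u) (-v) / 3 = triY (b + v) (-u) (-v) ∧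
    triZ (3 * a + r * u + u) (3 * b + r * v + v) (-u) (-v) / 3 = triZ (a + u) (b + v) (-u) (-v) := by
  unfold triX triY triZ
  rcases isUnitPair_iff.1 h with
    ⟨rfl, rfl⟩ | ⟨rfl, rfl⟩ | ⟨rfl, rfl⟩ | ⟨rfl, rfl⟩ | ⟨rfl, rfl⟩ | ⟨rfl, rfl⟩ <;> omega

/-- The type of a triangle in the middle of an edge of a refined triangle, in residues modulo 3. -/
def IsMid (i j k : ℤ) : Prop :=
  (i % 3 = 1 ∧ j % 3 = 0 ∧ k % 3 = 1) ∨ (i % 3 = 0 ∧ j % 3 = 1 ∧ k % 3 = 1) ∨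
  (i % 3 = 1 ∧ j % 3 = 1 ∧ k % 3 = 2) ∨ (i % 3 = 1 ∧ j % 3 = 2 ∧ k % 3 = 1) ∨
  (i % 3 = 2 ∧ j % 3 = 1 ∧ k % 3 = 1) ∨ (i % 3 = 1 ∧ j % 3 = 1 ∧ k % 3 = 0)

/-- Cells are recognized by residues alone: whichever boundary edge a cell belongs to, it has this
type, so a refined triangle of another type is never a glued cell. -/
theorem cell_isMid {a b u v : ℤ} (h : IsUnitPair u v) :
    IsMid (triX (3 * a + u) (u + v) (-u)) (triY (3 * b + v) (u + v) (-u))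
      (triZ (3 * a + u) (3 * b + v) (u + v) (-u)) := by
  unfold triX triY triZ IsMid
  rcases isUnitPair_iff.1 h with
    ⟨rfl, rfl⟩ | ⟨rfl, rfl⟩ | ⟨rfl, rfl⟩ | ⟨rfl, rfl⟩ | ⟨rfl, rfl⟩ | ⟨rfl, rfl⟩ <;> omega

/-- The cell of an edge lies to the right of the middle third of the edge. -/
theorem cell_eq_right {a b u v : ℤ} (h : IsUnitPair u v) :
    triX (3 * a + 2 * u) (-u) (-v) = triX (3 * a + u) (u + v) (-u) ∧
    triY (3 * b + 2 * v) (-u) (-v) = triY (3 * b + v) (u + v) (-u) ∧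
    triZ (3 * a + 2 * u) (3 * b + 2 * v) (-u) (-v) =
      triZ (3 * a + u) (3 * b + v) (u + v) (-u) := by
  unfold triX triY triZ
  rcases isUnitPair_iff.1 h with
    ⟨rfl, rfl⟩ | ⟨rfl, rfl⟩ | ⟨rfl, rfl⟩ | ⟨rfl, rfl⟩ | ⟨rfl, rfl⟩ | ⟨rfl, rfl⟩ <;> omega

/-- The left triangle of an edge does not change under rotation of the triangle. -/
theorem triangle_rotate {a b u v : ℤ} (h : IsUnitPair u v) :
    triX (a + u) (-u - v) u = triX a u v ∧ triY (b + v) (-u - v) u = triY b u v ∧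
      triZ (a + u) (b + v) (-u - v) u = triZ a b u v := by
  unfold triX triY triZ
  rcases isUnitPair_iff.1 h with
    ⟨rfl, rfl⟩ | ⟨rfl, rfl⟩ | ⟨rfl, rfl⟩ | ⟨rfl, rfl⟩ | ⟨rfl, rfl⟩ | ⟨rfl, rfl⟩ <;> omega

/-- Together with the next lemmas: the triangles to the right of the four new edges do not have the
residues of a cell, and their parent is the triangle to the right of the old edge. Hence they remain
empty. -/
theorem first_third_not_isMid {a b u v : ℤ} (h : IsUnitPair u v) :
    ¬ IsMid (triX (3 * a + u) (-u) (-v)) (triY (3 * b + v) (-u) (-v))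
      (triZ (3 * a + u) (3 * b + v) (-u) (-v)) := by
  unfold triX triY triZ IsMid
  rcases isUnitPair_iff.1 h with
    ⟨rfl, rfl⟩ | ⟨rfl, rfl⟩ | ⟨rfl, rfl⟩ | ⟨rfl, rfl⟩ | ⟨rfl, rfl⟩ | ⟨rfl, rfl⟩ <;> omega

theorem last_third_not_isMid {a b u v : ℤ} (h : IsUnitPair u v) :
    ¬ IsMid (triX (3 * a + 2 * u + u) (-u) (-v)) (triY (3 * b + 2 * v + v) (-u) (-v))
      (triZ (3 * a + 2 * u + u) (3 * b + 2 * v + v) (-u) (-v)) := by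
  unfold triX triY triZ IsMid
  rcases isUnitPair_iff.1 h with
    ⟨rfl, rfl⟩ | ⟨rfl, rfl⟩ | ⟨rfl, rfl⟩ | ⟨rfl, rfl⟩ | ⟨rfl, rfl⟩ | ⟨rfl, rfl⟩ <;> omega

theorem cell_first_right_not_isMid {a b u v : ℤ} (h : IsUnitPair u v) :
    ¬ IsMid (triX (3 * a + u + (u + v)) (-(u + v)) (- -u)) (triY (3 * b + v + -u) (-(u + v)) (- -u))
      (triZ (3 * a + u + (u + v)) (3 * b + v + -u) (-(u + v)) (- -u)) := by
  unfold triX triY triZ IsMid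
  rcases isUnitPair_iff.1 h with
    ⟨rfl, rfl⟩ | ⟨rfl, rfl⟩ | ⟨rfl, rfl⟩ | ⟨rfl, rfl⟩ | ⟨rfl, rfl⟩ | ⟨rfl, rfl⟩ <;> omega

theorem cell_first_right_parent {a b u v : ℤ} (h : IsUnitPair u v) :
    triX (3 * a + u + (u + v)) (-(u + v)) (- -u) / 3 = triX (a + u) (-u) (-v) ∧
    triY (3 * b + v + -u) (-(u + v)) (- -u) / 3 = triY (b + v) (-u) (-v) ∧
    triZ (3 * a + u + (u + v)) (3 * b + v + -u) (-(u + v)) (- -u) / 3 =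
      triZ (a + u) (b + v) (-u) (-v) := by
  unfold triX triY triZ
  rcases isUnitPair_iff.1 h with
    ⟨rfl, rfl⟩ | ⟨rfl, rfl⟩ | ⟨rfl, rfl⟩ | ⟨rfl, rfl⟩ | ⟨rfl, rfl⟩ | ⟨rfl, rfl⟩ <;> omega

theorem cell_second_right_not_isMid {a b u v : ℤ} (h : IsUnitPair u v) :
    ¬ IsMid (triX (3 * a + 2 * u + v + -v) (- -v) (-(u + v)))
      (triY (3 * b + v - u + (u + v)) (- -v) (-(u + v)))
      (triZ (3 * a + 2 * u + v + -v) (3 * b + v - u + (u + v)) (- -v) (-(u + v))) := by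
  unfold triX triY triZ IsMid
  rcases isUnitPair_iff.1 h with
    ⟨rfl, rfl⟩ | ⟨rfl, rfl⟩ | ⟨rfl, rfl⟩ | ⟨rfl, rfl⟩ | ⟨rfl, rfl⟩ | ⟨rfl, rfl⟩ <;> omega

theorem cell_second_right_parent {a b u v : ℤ} (h : IsUnitPair u v) :
    triX (3 * a + 2 * u + v + -v) (- -v) (-(u + v)) / 3 = triX (a + u) (-u) (-v) ∧
    triY (3 * b + v - u + (u + v)) (- -v) (-(u + v)) / 3 = triY (b + v) (-u) (-v) ∧
    triZ (3 * a + 2 * u + v + -v) (3 * b + v - u + (u + v)) (- -v) (-(u + v)) / 3 =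
      triZ (a + u) (b + v) (-u) (-v) := by
  unfold triX triY triZ
  rcases isUnitPair_iff.1 h with
    ⟨rfl, rfl⟩ | ⟨rfl, rfl⟩ | ⟨rfl, rfl⟩ | ⟨rfl, rfl⟩ | ⟨rfl, rfl⟩ | ⟨rfl, rfl⟩ <;> omega

/-- A triangle is to the left of exactly three edges. -/
theorem edges_of_triangle {a b u v a' b' u' v' : ℤ} (h : IsUnitPair u v) (h' : IsUnitPair u' v')
    (hx : triX a u v = triX a' u' v') (hy : triY b u v = triY b' u' v')
    (hz : triZ a b u v = triZ a' b' u' v') :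
    (a = a' ∧ b = b' ∧ u = u' ∧ v = v') ∨
    (a = a' + u' ∧ b = b' + v' ∧ u = -u' - v' ∧ v = u') ∨
    (a = a' - v' ∧ b = b' + u' + v' ∧ u = v' ∧ v = -u' - v') := by
  unfold triX triY triZ at *
  rcases isUnitPair_iff.1 h with
    ⟨rfl, rfl⟩ | ⟨rfl, rfl⟩ | ⟨rfl, rfl⟩ | ⟨rfl, rfl⟩ | ⟨rfl, rfl⟩ | ⟨rfl, rfl⟩ <;>
  rcases isUnitPair_iff.1 h' with
    ⟨rfl, rfl⟩ | ⟨rfl, rfl⟩ | ⟨rfl, rfl⟩ | ⟨rfl, rfl⟩ | ⟨rfl, rfl⟩ | ⟨rfl, rfl⟩ <;>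
  norm_num at hx hy hz ⊢ <;> omega

/-- An edge between triangles with different parents lies on a coarse edge. -/
theorem exists_coarse_edge {a b u v : ℤ} (h : IsUnitPair u v)
    (hne : ¬ (triX a u v / 3 = triX (a + u) (-u) (-v) / 3 ∧
      triY b u v / 3 = triY (b + v) (-u) (-v) / 3 ∧
      triZ a b u v / 3 = triZ (a + u) (b + v) (-u) (-v) / 3)) :
    ∃ a' b' r : ℤ, (r = 0 ∨ r = 1 ∨ r = 2) ∧ a = 3 * a' + r * u ∧ b = 3 * b' + r * v := by
  unfold triX triY triZ at *
  rcases isUnitPair_iff.1 h with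
    ⟨rfl, rfl⟩ | ⟨rfl, rfl⟩ | ⟨rfl, rfl⟩ | ⟨rfl, rfl⟩ | ⟨rfl, rfl⟩ | ⟨rfl, rfl⟩
  · exact ⟨a / 3, b / 3, a % 3, by omega, by omega, by omega⟩
  · exact ⟨a / 3, b / 3, b % 3, by omega, by omega, by omega⟩
  · exact ⟨(a + 2) / 3, b / 3, b % 3, by omega, by omega, by omega⟩
  · exact ⟨(a + 2) / 3, b / 3, (-a) % 3, by omega, by omega, by omega⟩
  · exact ⟨a / 3, (b + 2) / 3, (-b) % 3, by omega, by omega, by omega⟩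
  · exact ⟨a / 3, (b + 2) / 3, a % 3, by omega, by omega, by omega⟩

theorem grow_of_parent {P : ℤ → ℤ → ℤ → Prop} {i j k i' j' k' : ℤ} (hv : k = i + j ∨ k = i + j + 1)
    (h : i / 3 = i' ∧ j / 3 = j' ∧ k / 3 = k') (hP : P i' j' k') : grow P i j k := by
  obtain ⟨rfl, rfl, rfl⟩ := h
  exact ⟨hv, Or.inl hP⟩

theorem not_grow {P : ℤ → ℤ → ℤ → Prop} {i j k i' j' k' : ℤ} (hm : ¬ IsMid i j k)
    (h : i / 3 = i' ∧ j / 3 = j' ∧ k / 3 = k') (hP : ¬ P i' j' k') : ¬ grow P i j k := by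
  obtain ⟨rfl, rfl, rfl⟩ := h
  rintro ⟨-, h | ⟨a, b, u, v, hE, rfl, rfl, rfl⟩⟩
  · exact hP h
  · exact hm (cell_isMid hE.1)

theorem IsBdEdge.grow_cell {P : ℤ → ℤ → ℤ → Prop} {a b u v : ℤ} (h : IsBdEdge P a b u v) :
    LeftOf (grow P) (3 * a + u) (3 * b + v) (u + v) (-u) :=
  ⟨triangle_valid h.1.rotate_inv, Or.inr ⟨a, b, u, v, h, rfl, rfl, rfl⟩⟩

/-- The boundary edges after a step are the edges of the subdivision of the boundary. -/
theorem isBdEdge_grow {P : ℤ → ℤ → ℤ → Prop} {a b u v : ℤ} :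
    IsBdEdge (grow P) a b u v ↔ ∃ a' b' u' v', IsBdEdge P a' b' u' v' ∧
      ((a = 3 * a' ∧ b = 3 * b' ∧ u = u' ∧ v = v') ∨
       (a = 3 * a' + u' ∧ b = 3 * b' + v' ∧ u = u' + v' ∧ v = -u') ∨
       (a = 3 * a' + 2 * u' + v' ∧ b = 3 * b' + v' - u' ∧ u = -v' ∧ v = u' + v') ∨
       (a = 3 * a' + 2 * u' ∧ b = 3 * b' + 2 * v' ∧ u = u' ∧ v = v')) := by
  constructor
  · rintro ⟨hu, ⟨hv, hl⟩, hr⟩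
    rcases hl with hl | ⟨a', b', u', v', hE, hx, hy, hz⟩
    -- The left triangle has a filled parent and the right one an empty parent. The parents differ,
    -- so the edge is a third of a coarse edge, and `r` tells which third.
    · have hr' : ¬ P (triX (a + u) (-u) (-v) / 3) (triY (b + v) (-u) (-v) / 3)
          (triZ (a + u) (b + v) (-u) (-v) / 3) :=
        fun h => hr ⟨triangle_valid hu.neg, Or.inl h⟩
      obtain ⟨a', b', r, h3, rfl, rfl⟩ := exists_coarse_edge (a := a) (b := b) hu
        (fun ⟨h1, h2, h3⟩ => hr' (h1 ▸ h2 ▸ h3 ▸ hl))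
      have h0 : 0 ≤ r := by omega
      have h2 : r ≤ 2 := by omega
      have hE : IsBdEdge P a' b' u v := by
        obtain ⟨e1, e2, e3⟩ := triangle_parent (a := a') (b := b') hu h0 h2
        obtain ⟨f1, f2, f3⟩ := triangle_reverse_parent (a := a') (b := b') hu h0 h2
        rw [e1, e2, e3] at hl
        rw [f1, f2, f3] at hr'
        exact ⟨hu, hl, hr'⟩
      refine ⟨a', b', u, v, hE, ?_⟩
      rcases h3 with rfl | rfl | rfl
      · left; simp
      -- The middle third has the new cell on its right, so it is no longer a boundary edge.
      · exfalso
        apply hr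
        obtain ⟨e1, e2, e3⟩ := cell_eq_right (a := a') (b := b') hu
        have := hE.grow_cell
        unfold LeftOf at this ⊢
        rw [← e1, ← e2, ← e3] at this
        convert this using 2 <;> ring
      · right; right; right; simp
    · refine ⟨a', b', u', v', hE, ?_⟩
      rcases edges_of_triangle hu hE.1.rotate_inv hx hy hz with
        ⟨h1, h2, h3, h4⟩ | ⟨h1, h2, h3, h4⟩ | ⟨h1, h2, h3, h4⟩
      · right; left; exact ⟨h1, h2, h3, h4⟩
      · right; right; left; omega
      -- The third edge of the cell is its base, with the filled coarse triangle on the other side.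
      · exfalso
        apply hr
        rw [show a + u = 3 * a' + 1 * u' by omega, show b + v = 3 * b' + 1 * v' by omega,
          show -u = u' by omega, show -v = v' by omega]
        exact grow_of_parent (triangle_valid hE.1)
          (triangle_parent hE.1 (by simp) (by simp)) hE.2.1
  · rintro ⟨a', b', u', v', hE, h⟩
    obtain ⟨hu, hl, hr⟩ := id hE
    rcases h with ⟨rfl, rfl, rfl, rfl⟩ | ⟨rfl, rfl, rfl, rfl⟩ | ⟨rfl, rfl, rfl, rfl⟩ |
      ⟨rfl, rfl, rfl, rfl⟩
    · refine ⟨hu, grow_of_parent (triangle_valid hu) ?_ hl,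
        not_grow (first_third_not_isMid hu) ?_ hr⟩
      · simpa using triangle_parent (a := a') (b := b') (r := 0) hu (by simp) (by simp)
      · simpa using triangle_reverse_parent (a := a') (b := b') (r := 0) hu (by simp) (by simp)
    · exact ⟨hu.rotate_inv, hE.grow_cell,
        not_grow (cell_first_right_not_isMid hu) (cell_first_right_parent hu) hr⟩
    · refine ⟨hu.rotate, ?_,
        not_grow (cell_second_right_not_isMid hu) (cell_second_right_parent hu) hr⟩
      have := hE.grow_cell
      obtain ⟨e1, e2, e3⟩ := triangle_rotate (a := 3 * a' + u') (b := 3 * b' + v') hu.rotate_inv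
      unfold LeftOf at this ⊢
      rw [← e1, ← e2, ← e3] at this
      convert this using 2 <;> ring
    · exact ⟨hu, grow_of_parent (triangle_valid hu)
        (triangle_parent hu (by simp) (by simp)) hl, not_grow (last_third_not_isMid hu)
        (triangle_reverse_parent hu (by simp) (by simp)) hr⟩

theorem isBdEdge_zero {a b u v : ℤ} : IsBdEdge (Filled 0) a b u v ↔
    (a = 0 ∧ b = 0 ∧ u = 1 ∧ v = 0) ∨ (a = 1 ∧ b = 0 ∧ u = -1 ∧ v = 1) ∨
      (a = 0 ∧ b = 1 ∧ u = 0 ∧ v = -1) := by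
  constructor
  · rintro ⟨h, ⟨h1, h2, h3⟩, -⟩
    unfold triX triY triZ at *
    rcases isUnitPair_iff.1 h with
      ⟨rfl, rfl⟩ | ⟨rfl, rfl⟩ | ⟨rfl, rfl⟩ | ⟨rfl, rfl⟩ | ⟨rfl, rfl⟩ | ⟨rfl, rfl⟩ <;>
    norm_num at h1 h2 h3 ⊢ <;> omega
  · rintro (⟨rfl, rfl, rfl, rfl⟩ | ⟨rfl, rfl, rfl, rfl⟩ | ⟨rfl, rfl, rfl, rfl⟩) <;>
      norm_num [IsBdEdge, IsUnitPair, LeftOf, Filled, triX, triY, triZ]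

/-! ### Oblique coordinates; sides as lattice edges -/

theorem dir_eq : dir = ⟨1 / 2, √3 / 2⟩ := by
  unfold dir
  rw [Complex.exp_mul_I, ← Complex.ofReal_cos, ← Complex.ofReal_sin, Real.cos_pi_div_three,
    Real.sin_pi_div_three]
  apply Complex.ext <;> simp

theorem dir_sq : dir * dir = dir - 1 := by
  have h : √3 * √3 = 3 := Real.mul_self_sqrt (by norm_num)
  rw [dir_eq]
  apply Complex.ext <;> simp <;> linarith

theorem exp_neg_eq : Complex.exp (-(π / 3 : ℝ) * Complex.I) = 1 - dir := by
  have h : Complex.exp (-(π / 3 : ℝ) * Complex.I) * dir = 1 := by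
    unfold dir
    rw [← Complex.exp_add, neg_mul, neg_add_cancel, Complex.exp_zero]
  linear_combination (1 - dir) * h + Complex.exp (-(π / 3 : ℝ) * Complex.I) * dir_sq

/-- The point with coordinates `x`, `y` in the basis `1`, `ω` of the plane. -/
def pt (x y : ℝ) : ℂ := x + y * dir

/-- The first coordinate in the basis `1`, `ω`, in units of `3⁻ⁿ`. -/
def cX (n : ℕ) : ℂ →L[ℝ] ℝ := (3 ^ n : ℝ) • (Complex.reCLM - (1 / √3) • Complex.imCLM)

/-- The second coordinate in the basis `1`, `ω`, in units of `3⁻ⁿ`. -/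
def cY (n : ℕ) : ℂ →L[ℝ] ℝ := (3 ^ n * (2 / √3) : ℝ) • Complex.imCLM

theorem cX_pt (n : ℕ) (x y : ℝ) : cX n (pt x y) = 3 ^ n * x := by
  have h : √3 ≠ 0 := by positivity
  simp [cX, pt, dir_eq]
  field_simp
  ring

theorem cY_pt (n : ℕ) (x y : ℝ) : cY n (pt x y) = 3 ^ n * y := by
  have h : √3 ≠ 0 := by positivity
  simp [cY, pt, dir_eq]
  field_simp

theorem cX_succ (n : ℕ) (z : ℂ) : cX (n + 1) z = 3 * cX n z := by
  simp [cX, pow_succ]; ring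

theorem cY_succ (n : ℕ) (z : ℂ) : cY (n + 1) z = 3 * cY n z := by
  simp [cY, pow_succ]; ring

theorem ext_coord {n : ℕ} {z w : ℂ} (hx : cX n z = cX n w) (hy : cY n z = cY n w) : z = w := by
  have h : √3 ≠ 0 := by positivity
  have him : z.im = w.im := by simpa [cY, h] using hy
  have hre : z.re = w.re := by simpa [cX, him] using hx
  exact Complex.ext hre him

/-- The point of the lattice of mesh `3⁻ⁿ` with integer coordinates `a`, `b`. -/
def latPt (n : ℕ) (a b : ℤ) : ℂ := pt (a / 3 ^ n) (b / 3 ^ n)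

@[simp] theorem cX_latPt (n : ℕ) (a b : ℤ) : cX n (latPt n a b) = a := by
  rw [latPt, cX_pt]; field_simp

@[simp] theorem cY_latPt (n : ℕ) (a b : ℤ) : cY n (latPt n a b) = b := by
  rw [latPt, cY_pt]; field_simp

/-- The directed lattice edge from `(a, b)` to `(a + u, b + v)`. -/
def edge (n : ℕ) (a b u v : ℤ) : Side := (latPt n a b, latPt n (a + u) (b + v))

theorem eq_edge_point_iff {n : ℕ} {a b u v : ℤ} {z : ℂ} {t : ℝ} :
    z = (edge n a b u v).1 + t • ((edge n a b u v).2 - (edge n a b u v).1) ↔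
      cX n z = a + t * u ∧ cY n z = b + t * v := by
  have hx : cX n ((edge n a b u v).1 + t • ((edge n a b u v).2 - (edge n a b u v).1)) =
      a + t * u := by
    simp only [edge, map_add, map_sub, map_smul, smul_eq_mul, cX_latPt]
    push_cast; ring
  have hy : cY n ((edge n a b u v).1 + t • ((edge n a b u v).2 - (edge n a b u v).1)) =
      b + t * v := by
    simp only [edge, map_add, map_sub, map_smul, smul_eq_mul, cY_latPt]
    push_cast; ring
  exact ⟨fun h => h ▸ ⟨hx, hy⟩, fun h => ext_coord (h.1.trans hx.symm) (h.2.trans hy.symm)⟩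

theorem mem_segment_edge {n : ℕ} {a b u v : ℤ} {z : ℂ} :
    z ∈ segment ℝ (edge n a b u v).1 (edge n a b u v).2 ↔
      ∃ t : ℝ, (0 ≤ t ∧ t ≤ 1) ∧ cX n z = a + t * u ∧ cY n z = b + t * v := by
  rw [segment_eq_image']
  simp only [Set.mem_image, Set.mem_Icc, ← eq_edge_point_iff, eq_comm (a := z)]

theorem mem_openSegment_edge {n : ℕ} {a b u v : ℤ} {z : ℂ} :
    z ∈ openSegment ℝ (edge n a b u v).1 (edge n a b u v).2 ↔
      ∃ t : ℝ, (0 < t ∧ t < 1) ∧ cX n z = a + t * u ∧ cY n z = b + t * v := by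
  rw [openSegment_eq_image']
  simp only [Set.mem_image, Set.mem_Ioo, ← eq_edge_point_iff, eq_comm (a := z)]

theorem left_edge (n : ℕ) (a b u v : ℤ) :
    (edge n a b u v).left = latPt (n + 1) (3 * a + u) (3 * b + v) := by
  simp only [Side.left, edge, latPt, pt, Complex.real_smul]
  push_cast
  field_simp
  ring

theorem right_edge (n : ℕ) (a b u v : ℤ) :
    (edge n a b u v).right = latPt (n + 1) (3 * a + 2 * u) (3 * b + 2 * v) := by
  simp only [Side.right, edge, latPt, pt, Complex.real_smul]
  push_cast
  field_simp
  ring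

theorem apex_edge (n : ℕ) (a b u v : ℤ) :
    (edge n a b u v).apex = latPt (n + 1) (3 * a + 2 * u + v) (3 * b + v - u) := by
  rw [Side.apex, exp_neg_eq, left_edge, right_edge]
  simp only [latPt, pt]
  push_cast
  field_simp
  linear_combination (-(v : ℂ)) * dir_sq

theorem latPt_succ (n : ℕ) (a b : ℤ) : latPt (n + 1) (3 * a) (3 * b) = latPt n a b := by
  simp only [latPt, pt]
  push_cast
  field_simp
  ring

theorem subdivide_edge (n : ℕ) (a b u v : ℤ) : (edge n a b u v).subdivide =
    [edge (n + 1) (3 * a) (3 * b) u v, edge (n + 1) (3 * a + u) (3 * b + v) (u + v) (-u),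
      edge (n + 1) (3 * a + 2 * u + v) (3 * b + v - u) (-v) (u + v),
      edge (n + 1) (3 * a + 2 * u) (3 * b + 2 * v) u v] := by
  rw [Side.subdivide, left_edge, right_edge, apex_edge]
  have e1 : (edge n a b u v).1 = latPt (n + 1) (3 * a) (3 * b) := (latPt_succ n a b).symm
  have e2 : (edge n a b u v).2 = latPt (n + 1) (3 * a + 2 * u + u) (3 * b + 2 * v + v) := by
    rw [show 3 * a + 2 * u + u = 3 * (a + u) by ring,
      show 3 * b + 2 * v + v = 3 * (b + v) by ring, latPt_succ, edge]
  rw [e1, e2]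
  simp only [edge]
  ring_nf

/-- The bridge between the recursion on sides and the lattice: the four edges in `isBdEdge_grow` are
the four sides in `subdivide_edge`. -/
theorem mem_sides {n : ℕ} {s : Side} : s ∈ sides n ↔
    ∃ a b u v, IsBdEdge (Filled n) a b u v ∧ s = edge n a b u v := by
  induction n generalizing s with
  | zero =>
    have e1 : edge 0 0 0 1 0 = (0, 1) := by simp [edge, latPt, pt]
    have e2 : edge 0 1 0 (-1) 1 = (1, top) := by simp [edge, latPt, pt, top, dir]
    have e3 : edge 0 0 1 0 (-1) = (top, 0) := by simp [edge, latPt, pt, top, dir]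
    simp only [sides, List.mem_cons, List.not_mem_nil, or_false, isBdEdge_zero, ← e1, ← e2, ← e3]
    constructor
    · rintro (rfl | rfl | rfl)
      · exact ⟨_, _, _, _, by simp, rfl⟩
      · exact ⟨_, _, _, _, by simp, rfl⟩
      · exact ⟨_, _, _, _, by simp, rfl⟩
    · rintro ⟨a, b, u, v, ⟨rfl, rfl, rfl, rfl⟩ | ⟨rfl, rfl, rfl, rfl⟩ | ⟨rfl, rfl, rfl, rfl⟩, rfl⟩ <;>
        simp
  | succ n ih =>
    simp only [sides, List.mem_flatMap]
    constructor
    · rintro ⟨s', hs', hs⟩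
      obtain ⟨a, b, u, v, hE, rfl⟩ := ih.1 hs'
      rw [subdivide_edge] at hs
      simp only [List.mem_cons, List.not_mem_nil, or_false] at hs
      rcases hs with rfl | rfl | rfl | rfl
      · exact ⟨_, _, _, _, isBdEdge_grow.2 ⟨a, b, u, v, hE, Or.inl ⟨rfl, rfl, rfl, rfl⟩⟩, rfl⟩
      · exact ⟨_, _, _, _, isBdEdge_grow.2 ⟨a, b, u, v, hE, Or.inr (Or.inl ⟨rfl, rfl, rfl, rfl⟩)⟩, rfl⟩
      · exact ⟨_, _, _, _, isBdEdge_grow.2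
          ⟨a, b, u, v, hE, Or.inr (Or.inr (Or.inl ⟨rfl, rfl, rfl, rfl⟩))⟩, rfl⟩
      · exact ⟨_, _, _, _, isBdEdge_grow.2
          ⟨a, b, u, v, hE, Or.inr (Or.inr (Or.inr ⟨rfl, rfl, rfl, rfl⟩))⟩, rfl⟩
    · rintro ⟨a, b, u, v, hE, rfl⟩
      obtain ⟨a', b', u', v', hE', h⟩ := isBdEdge_grow.1 hE
      refine ⟨edge n a' b' u' v', ih.2 ⟨_, _, _, _, hE', rfl⟩, ?_⟩
      rw [subdivide_edge]
      rcases h with ⟨rfl, rfl, rfl, rfl⟩ | ⟨rfl, rfl, rfl, rfl⟩ | ⟨rfl, rfl, rfl, rfl⟩ |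
        ⟨rfl, rfl, rfl, rfl⟩ <;> simp

/-! ### The table as a union of lattice triangles -/

/-- The closed lattice triangle with lower bounds `i`, `j`, `k`. -/
def InTri (n : ℕ) (z : ℂ) (i j k : ℤ) : Prop :=
  (i ≤ cX n z ∧ cX n z ≤ i + 1) ∧ (j ≤ cY n z ∧ cY n z ≤ j + 1) ∧
    (k ≤ cX n z + cY n z ∧ cX n z + cY n z ≤ k + 1)

/-- The open lattice triangle with lower bounds `i`, `j`, `k`. -/
def InOpenTri (n : ℕ) (z : ℂ) (i j k : ℤ) : Prop :=
  (i < cX n z ∧ cX n z < i + 1) ∧ (j < cY n z ∧ cY n z < j + 1) ∧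
    (k < cX n z + cY n z ∧ cX n z + cY n z < k + 1)

theorem mem_convexHull_triple {p q r z : ℂ} : z ∈ convexHull ℝ {p, q, r} ↔
    ∃ s t : ℝ, 0 ≤ s ∧ 0 ≤ t ∧ s + t ≤ 1 ∧ z = p + s • (q - p) + t • (r - p) := by
  rw [convexHull_insert (by simp), convexHull_pair, mem_convexJoin]
  simp only [Set.mem_singleton_iff, exists_eq_left, segment_eq_image', Set.mem_image, Set.mem_Icc]
  constructor
  · rintro ⟨_, ⟨x, ⟨hx, hx'⟩, rfl⟩, y, ⟨hy, hy'⟩, rfl⟩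
    refine ⟨y * (1 - x), y * x, by nlinarith, by positivity, by nlinarith, ?_⟩
    simp only [Complex.real_smul]
    push_cast
    ring
  · rintro ⟨s, t, hs, ht, hst, rfl⟩
    rcases eq_or_lt_of_le (add_nonneg hs ht) with h | h
    · obtain rfl : s = 0 := by linarith
      obtain rfl : t = 0 := by linarith
      exact ⟨q, ⟨0, by simp, by simp⟩, 0, by simp, by simp⟩
    · have h' : ((s + t : ℝ) : ℂ) ≠ 0 := by exact_mod_cast h.ne'
      refine ⟨_, ⟨t / (s + t), ⟨by positivity, ?_⟩, rfl⟩, s + t, ⟨h.le, hst⟩, ?_⟩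
      · rw [div_le_one h]; linarith
      · simp only [Complex.real_smul]
        push_cast at h' ⊢
        field_simp
        ring

theorem mem_convexHull_left_triangle {n : ℕ} {a b u v : ℤ} (h : IsUnitPair u v) {z : ℂ} :
    z ∈ convexHull ℝ {latPt n a b, latPt n (a + u) (b + v), latPt n (a - v) (b + u + v)} ↔
      LeftOf (InTri n z) a b u v := by
  have key : (∃ s t : ℝ, 0 ≤ s ∧ 0 ≤ t ∧ s + t ≤ 1 ∧ cX n z = a + s * u - t * v ∧
      cY n z = b + s * v + t * (u + v)) ↔ LeftOf (InTri n z) a b u v := by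
    unfold LeftOf InTri triX triY triZ
    constructor
    · rintro ⟨s, t, hs, ht, hst, h1, h2⟩
      rw [h1, h2]
      rcases isUnitPair_iff.1 h with
        ⟨rfl, rfl⟩ | ⟨rfl, rfl⟩ | ⟨rfl, rfl⟩ | ⟨rfl, rfl⟩ | ⟨rfl, rfl⟩ | ⟨rfl, rfl⟩ <;>
      · norm_num
        refine ⟨⟨?_, ?_⟩, ⟨?_, ?_⟩, ?_, ?_⟩ <;> linarith
    · rintro ⟨⟨h1, h2⟩, ⟨h3, h4⟩, h5, h6⟩
      -- Solution of the linear system for `s`, `t`; its determinant is `u * u + u * v + v * v = 1`.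
      refine ⟨(u + v) * (cX n z - a) + v * (cY n z - b), -v * (cX n z - a) + u * (cY n z - b), ?_⟩
      rcases isUnitPair_iff.1 h with
        ⟨rfl, rfl⟩ | ⟨rfl, rfl⟩ | ⟨rfl, rfl⟩ | ⟨rfl, rfl⟩ | ⟨rfl, rfl⟩ | ⟨rfl, rfl⟩ <;>
      · norm_num at h1 h2 h3 h4 h5 h6
        refine ⟨?_, ?_, ?_, ?_, ?_⟩ <;> push_cast <;> linarith
  rw [← key, mem_convexHull_triple]
  refine exists_congr fun s => exists_congr fun t => and_congr_right fun _ => and_congr_right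
    fun _ => and_congr_right fun _ => ?_
  have hx : cX n (latPt n a b + s • (latPt n (a + u) (b + v) - latPt n a b) +
      t • (latPt n (a - v) (b + u + v) - latPt n a b)) = a + s * u - t * v := by
    simp only [map_add, map_sub, map_smul, smul_eq_mul, cX_latPt]
    push_cast; ring
  have hy : cY n (latPt n a b + s • (latPt n (a + u) (b + v) - latPt n a b) +
      t • (latPt n (a - v) (b + u + v) - latPt n a b)) = b + s * v + t * (u + v) := by
    simp only [map_add, map_sub, map_smul, smul_eq_mul, cY_latPt]
    push_cast; ring
  exact ⟨fun h => h ▸ ⟨hx, hy⟩, fun h => ext_coord (h.1.trans hx.symm) (h.2.trans hy.symm)⟩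

theorem InOpenTri.inTri {n : ℕ} {z : ℂ} {i j k : ℤ} (h : InOpenTri n z i j k) : InTri n z i j k :=
  ⟨⟨h.1.1.le, h.1.2.le⟩, ⟨h.2.1.1.le, h.2.1.2.le⟩, h.2.2.1.le, h.2.2.2.le⟩

theorem InOpenTri.unique {n : ℕ} {z : ℂ} {i j k i' j' k' : ℤ} (h : InOpenTri n z i j k)
    (h' : InTri n z i' j' k') : i' = i ∧ j' = j ∧ k' = k := by
  have key : ∀ {x : ℝ} {m m' : ℤ}, (m < x ∧ x < m + 1) → (m' ≤ x ∧ x ≤ m' + 1) → m' = m := by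
    intro x m m' h h'
    have h1 : (m : ℝ) < m' + 1 := by linarith
    have h2 : (m' : ℝ) < m + 1 := by linarith
    norm_cast at h1 h2
    omega
  exact ⟨key h.1 h'.1, key h.2.1 h'.2.1, key h.2.2 h'.2.2⟩

theorem mem_cell_edge {n : ℕ} {a b u v : ℤ} (h : IsUnitPair u v) {z : ℂ} :
    z ∈ (edge n a b u v).cell ↔
      LeftOf (InTri (n + 1) z) (3 * a + u) (3 * b + v) (u + v) (-u) := by
  rw [← mem_convexHull_left_triangle h.rotate_inv, Side.cell, left_edge, right_edge, apex_edge,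
    show 3 * a + u + (u + v) = 3 * a + 2 * u + v by ring,
    show 3 * b + v + -u = 3 * b + v - u by ring, show 3 * a + u - -u = 3 * a + 2 * u by ring,
    show 3 * b + v + (u + v) + -u = 3 * b + 2 * v by ring]

theorem InTri.of_succ {n : ℕ} {z : ℂ} {i j k : ℤ} (h : InTri (n + 1) z i j k) :
    InTri n z (i / 3) (j / 3) (k / 3) := by
  have key : ∀ {x : ℝ} {m : ℤ}, (m ≤ 3 * x ∧ 3 * x ≤ m + 1) →
      (((m / 3 : ℤ) : ℝ) ≤ x ∧ x ≤ ((m / 3 : ℤ) : ℝ) + 1) := by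
    intro x m h
    have h1 : ((3 * (m / 3) : ℤ) : ℝ) ≤ m := by exact_mod_cast (by omega : 3 * (m / 3) ≤ m)
    have h2 : (m : ℝ) + 1 ≤ ((3 * (m / 3) + 3 : ℤ) : ℝ) := by
      exact_mod_cast (by omega : m + 1 ≤ 3 * (m / 3) + 3)
    push_cast at h1 h2
    constructor <;> linarith
  unfold InTri at *
  rw [cX_succ, cY_succ, ← mul_add] at h
  exact ⟨key h.1, key h.2.1, key h.2.2⟩

/-- A lattice triangle is covered by its nine parts. -/
theorem InTri.exists_succ {n : ℕ} {z : ℂ} {i j k : ℤ} (hv : k = i + j ∨ k = i + j + 1)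
    (h : InTri n z i j k) : ∃ i' j' k', (k' = i' + j' ∨ k' = i' + j' + 1) ∧
      (i' / 3 = i ∧ j' / 3 = j ∧ k' / 3 = k) ∧ InTri (n + 1) z i' j' k' := by
  unfold InTri
  rw [cX_succ, cY_succ]
  obtain ⟨⟨h1, h2⟩, ⟨h3, h4⟩, h5, h6⟩ := h
  set x := cX n z
  set y := cY n z
  have key : ∃ α β γ : ℤ, (3 * k + γ = 3 * i + α + (3 * j + β) ∨
      3 * k + γ = 3 * i + α + (3 * j + β) + 1) ∧
      (α = 0 ∨ α = 1 ∨ α = 2) ∧ (β = 0 ∨ β = 1 ∨ β = 2) ∧ (γ = 0 ∨ γ = 1 ∨ γ = 2) ∧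
      (α ≤ 3 * (x - i) ∧ 3 * (x - i) ≤ α + 1) ∧ (β ≤ 3 * (y - j) ∧ 3 * (y - j) ≤ β + 1) ∧
      (γ ≤ 3 * (x + y - k) ∧ 3 * (x + y - k) ≤ γ + 1) := by
    have third : ∀ {x : ℝ}, 0 ≤ x → x ≤ 1 →
        ∃ α : ℤ, (α = 0 ∨ α = 1 ∨ α = 2) ∧ α ≤ 3 * x ∧ 3 * x ≤ α + 1 := by
      intro x h h'
      rcases le_total (3 * x) 1 with h1 | h1
      · exact ⟨0, by simp, by push_cast; linarith, by push_cast; linarith⟩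
      · rcases le_total (3 * x) 2 with h2 | h2
        · exact ⟨1, by simp, by push_cast; linarith, by push_cast; linarith⟩
        · exact ⟨2, by simp, by push_cast; linarith, by push_cast; linarith⟩
    obtain ⟨α, hα, a1, a2⟩ := third (x := x - i) (by linarith) (by linarith)
    obtain ⟨β, hβ, b1, b2⟩ := third (x := y - j) (by linarith) (by linarith)
    obtain ⟨γ, hγ, c1, c2⟩ := third (x := x + y - k) (by linarith) (by linarith)
    have g1 : 3 * i + α + (3 * j + β) ≤ 3 * k + γ + 1 := by
      have : (3 * i + α + (3 * j + β) : ℝ) ≤ 3 * k + γ + 1 := by linarith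
      exact_mod_cast this
    have g2 : 3 * k + γ ≤ 3 * i + α + (3 * j + β) + 2 := by
      have : (3 * k + γ : ℝ) ≤ 3 * i + α + (3 * j + β) + 2 := by linarith
      exact_mod_cast this
    -- The three digits were chosen independently and need not name a triangle. If they do not, the
    -- inequalities are forced to be equalities, the point is on a lattice line, and one digit can
    -- be moved by one.
    rcases (by omega : (3 * k + γ = 3 * i + α + (3 * j + β) ∨
        3 * k + γ = 3 * i + α + (3 * j + β) + 1) ∨ 3 * i + α + (3 * j + β) = 3 * k + γ + 1 ∨
        3 * k + γ = 3 * i + α + (3 * j + β) + 2) with h0 | h0 | h0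
    · exact ⟨α, β, γ, h0, hα, hβ, hγ, ⟨a1, a2⟩, ⟨b1, b2⟩, c1, c2⟩
    · have h0' : (3 * i + α + (3 * j + β) : ℝ) = 3 * k + γ + 1 := by exact_mod_cast h0
      rcases (by omega : 1 ≤ α ∨ 1 ≤ β) with h | h
      · exact ⟨α - 1, β, γ, by omega, by omega, hβ, hγ,
          ⟨by push_cast; linarith, by push_cast; linarith⟩, ⟨b1, b2⟩, c1, c2⟩
      · exact ⟨α, β - 1, γ, by omega, hα, by omega, hγ, ⟨a1, a2⟩,
          ⟨by push_cast; linarith, by push_cast; linarith⟩, c1, c2⟩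
    · have h0' : (3 * k + γ : ℝ) = 3 * i + α + (3 * j + β) + 2 := by exact_mod_cast h0
      rcases (by omega : α ≤ 1 ∨ β ≤ 1) with h | h
      · exact ⟨α + 1, β, γ, by omega, by omega, hβ, hγ,
          ⟨by push_cast; linarith, by push_cast; linarith⟩, ⟨b1, b2⟩, c1, c2⟩
      · exact ⟨α, β + 1, γ, by omega, hα, by omega, hγ, ⟨a1, a2⟩,
          ⟨by push_cast; linarith, by push_cast; linarith⟩, c1, c2⟩
  obtain ⟨α, β, γ, hv', hα, hβ, hγ, ⟨e1, e2⟩, ⟨e3, e4⟩, e5, e6⟩ := key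
  refine ⟨3 * i + α, 3 * j + β, 3 * k + γ, hv', ⟨by omega, by omega, by omega⟩, ?_⟩
  push_cast
  refine ⟨⟨?_, ?_⟩, ⟨?_, ?_⟩, ?_, ?_⟩ <;> linarith

theorem mem_table {n : ℕ} {z : ℂ} : z ∈ table n ↔ ∃ i j k, Filled n i j k ∧ InTri n z i j k := by
  induction n generalizing z with
  | zero =>
    have h := mem_convexHull_left_triangle (n := 0) (a := 0) (b := 0) (u := 1) (v := 0) (z := z)
      (by norm_num [IsUnitPair])
    have e1 : latPt 0 0 0 = 0 := by simp [latPt, pt]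
    have e2 : latPt 0 (0 + 1) (0 + 0) = 1 := by simp [latPt, pt]
    have e3 : latPt 0 (0 - 0) (0 + 1 + 0) = top := by simp [latPt, pt, top, dir]
    rw [e1, e2, e3] at h
    rw [table, h]
    simp [LeftOf, triX, triY, triZ, Filled]
  | succ n ih =>
    simp only [table, Set.mem_union, ih, Set.mem_ofPred_eq]
    constructor
    · rintro (⟨i, j, k, hF, hz⟩ | ⟨s, hs, hz⟩)
      · obtain ⟨i', j', k', hv, ⟨rfl, rfl, rfl⟩, hz'⟩ := hz.exists_succ hF.valid
        exact ⟨i', j', k', ⟨hv, Or.inl hF⟩, hz'⟩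
      · obtain ⟨a, b, u, v, hE, rfl⟩ := mem_sides.1 hs
        exact ⟨_, _, _, hE.grow_cell, (mem_cell_edge hE.1).1 hz⟩
    · rintro ⟨i, j, k, ⟨hv, h | ⟨a, b, u, v, hE, rfl, rfl, rfl⟩⟩, hz⟩
      · exact Or.inl ⟨_, _, _, h, hz.of_succ⟩
      · exact Or.inr ⟨_, mem_sides.2 ⟨a, b, u, v, hE, rfl⟩, (mem_cell_edge hE.1).2 hz⟩

theorem isCompact_table (n : ℕ) : IsCompact (table n) := by
  induction n with
  | zero => exact (Set.toFinite _).isCompact_convexHull ℝ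
  | succ n ih =>
    refine ih.union ?_
    have : {z | ∃ s ∈ sides n, z ∈ s.cell} = ⋃ s ∈ {s | s ∈ sides n}, s.cell := by
      ext z; simp
    rw [this]
    exact (List.finite_toSet (sides n)).isCompact_biUnion
      fun s _ => (Set.toFinite _).isCompact_convexHull ℝ

theorem table_mono {m n : ℕ} (h : m ≤ n) : table m ⊆ table n :=
  monotone_nat_of_le_succ (fun _ => Set.subset_union_left) h

/-! ### The open region is the interior of the table -/

theorem mem_KS {n : ℕ} {z : ℂ} : z ∈ KS n ↔ ∃ a b u v, IsBdEdge (Filled n) a b u v ∧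
    ∃ t : ℝ, (0 ≤ t ∧ t ≤ 1) ∧ cX n z = a + t * u ∧ cY n z = b + t * v := by
  constructor
  · rintro ⟨s, hs, hz⟩
    obtain ⟨a, b, u, v, hE, rfl⟩ := mem_sides.1 hs
    exact ⟨a, b, u, v, hE, mem_segment_edge.1 hz⟩
  · rintro ⟨a, b, u, v, hE, hz⟩
    exact ⟨_, mem_sides.2 ⟨a, b, u, v, hE, rfl⟩, mem_segment_edge.2 hz⟩

/-- Off the curve, the triangles on the two sides of an edge are both filled or both not. -/
theorem leftOf_reverse {n : ℕ} {z : ℂ} (hz : z ∉ KS n) {a b u v : ℤ} (h : IsUnitPair u v)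
    (hF : LeftOf (Filled n) a b u v) (h1 : LeftOf (InTri n z) a b u v)
    (h2 : LeftOf (InTri n z) (a + u) (b + v) (-u) (-v)) :
    LeftOf (Filled n) (a + u) (b + v) (-u) (-v) := by
  by_contra hF'
  -- The parameter of `z` on the common edge is the inner product, in oblique coordinates, with the
  -- unit vector of the edge.
  refine hz (mem_KS.2 ⟨a, b, u, v, ⟨h, hF, hF'⟩,
    (2 * u + v) / 2 * (cX n z - a) + (2 * v + u) / 2 * (cY n z - b), ?_⟩)
  obtain ⟨⟨g1, g2⟩, ⟨g3, g4⟩, g5, g6⟩ := h1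
  obtain ⟨⟨k1, k2⟩, ⟨k3, k4⟩, k5, k6⟩ := h2
  unfold triX triY triZ at *
  clear hF hF'
  rcases isUnitPair_iff.1 h with
    ⟨rfl, rfl⟩ | ⟨rfl, rfl⟩ | ⟨rfl, rfl⟩ | ⟨rfl, rfl⟩ | ⟨rfl, rfl⟩ | ⟨rfl, rfl⟩ <;>
  · norm_num at g1 g2 g3 g4 g5 g6 k1 k2 k3 k4 k5 k6
    refine ⟨⟨?_, ?_⟩, ?_, ?_⟩ <;> push_cast <;> linarith

/-- Walk from one triangle at `z` to the other across edges through `z`. Both contain `z`, so their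
bounds differ by at most one. Each crossing brings one bound to its target, and by `leftOf_reverse`
being filled is preserved because `z` is off the curve. -/
theorem filled_of_mem_inTri {n : ℕ} {z : ℂ} (hz : z ∉ KS n) {i j k i' j' k' : ℤ}
    (hF : Filled n i j k) (h : InTri n z i j k) (hv' : k' = i' + j' ∨ k' = i' + j' + 1)
    (h' : InTri n z i' j' k') : Filled n i' j' k' := by
  induction hm : (i - i').natAbs + (j - j').natAbs + (k - k').natAbs using Nat.strong_induction_on
    generalizing i j k with
  | _ m ih =>
  have flip : ∀ a b u v : ℤ, IsUnitPair u v → i = triX a u v → j = triY b u v → k = triZ a b u v →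
      InTri n z (triX (a + u) (-u) (-v)) (triY (b + v) (-u) (-v))
        (triZ (a + u) (b + v) (-u) (-v)) →
      (triX (a + u) (-u) (-v) - i').natAbs + (triY (b + v) (-u) (-v) - j').natAbs +
        (triZ (a + u) (b + v) (-u) (-v) - k').natAbs < m → Filled n i' j' k' := by
    rintro a b u v hu rfl rfl rfl hz' hlt
    exact ih _ hlt (leftOf_reverse hz hu hF h hz') hz' rfl
  have hne : ∀ {x : ℝ} {m m' : ℤ}, (m ≤ x ∧ x ≤ m + 1) → (m' ≤ x ∧ x ≤ m' + 1) →
      m' ≤ m + 1 ∧ m ≤ m' + 1 := by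
    rintro x m m' ⟨h1, h2⟩ ⟨h3, h4⟩
    exact ⟨by exact_mod_cast h3.trans h2, by exact_mod_cast h1.trans h4⟩
  have hi := hne h.1 h'.1
  have hj := hne h.2.1 h'.2.1
  have hk := hne h.2.2 h'.2.2
  -- The orientation of the triangle decides which crossings exist: with `k = i + j` they lower `i`,
  -- lower `j` or raise `k`, and in the other case the opposite.
  rcases hF.valid with hv | hv
  · by_cases c1 : i' = i - 1
    · have e1 : triX (i + 0) (-0) (- -1) = i' := by simp [triX]; omega
      have e2 : triY (j + 1 + -1) (-0) (- -1) = j := by simp [triY]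
      have e3 : triZ (i + 0) (j + 1 + -1) (-0) (- -1) = k := by simp [triZ]; omega
      refine flip i (j + 1) 0 (-1) (by norm_num [IsUnitPair]) (by simp [triX]) (by simp [triY])
        (by simp [triZ]; omega) ?_ ?_
      · rw [e1, e2, e3]; exact ⟨h'.1, h.2.1, h.2.2⟩
      · rw [e1, e2, e3]; omega
    by_cases c2 : j' = j - 1
    · have e1 : triX (i + 1) (-1) (-0) = i := by simp [triX]
      have e2 : triY (j + 0) (-1) (-0) = j' := by simp [triY]; omega
      have e3 : triZ (i + 1) (j + 0) (-1) (-0) = k := by simp [triZ]; omega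
      refine flip i j 1 0 (by norm_num [IsUnitPair]) (by simp [triX]) (by simp [triY])
        (by simp [triZ]; omega) ?_ ?_
      · rw [e1, e2, e3]; exact ⟨h.1, h'.2.1, h.2.2⟩
      · rw [e1, e2, e3]; omega
    by_cases c3 : k' = k + 1
    · have e1 : triX (i + 1 + -1) (- -1) (-1) = i := by simp [triX]
      have e2 : triY (j + 1) (- -1) (-1) = j := by simp [triY]
      have e3 : triZ (i + 1 + -1) (j + 1) (- -1) (-1) = k' := by simp [triZ]; omega
      refine flip (i + 1) j (-1) 1 (by norm_num [IsUnitPair]) (by simp [triX]) (by simp [triY])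
        (by simp [triZ]; omega) ?_ ?_
      · rw [e1, e2, e3]; exact ⟨h.1, h.2.1, h'.2.2⟩
      · rw [e1, e2, e3]; omega
    obtain ⟨rfl, rfl, rfl⟩ : i' = i ∧ j' = j ∧ k' = k := by omega
    exact hF
  · by_cases c1 : i' = i + 1
    · have e1 : triX (i + 1 + 0) (-0) (-1) = i' := by simp [triX]; omega
      have e2 : triY (j + 1) (-0) (-1) = j := by simp [triY]
      have e3 : triZ (i + 1 + 0) (j + 1) (-0) (-1) = k := by simp [triZ]; omega
      refine flip (i + 1) j 0 1 (by norm_num [IsUnitPair]) (by simp [triX]) (by simp [triY])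
        (by simp [triZ]; omega) ?_ ?_
      · rw [e1, e2, e3]; exact ⟨h'.1, h.2.1, h.2.2⟩
      · rw [e1, e2, e3]; omega
    by_cases c2 : j' = j + 1
    · have e1 : triX (i + 1 + -1) (- -1) (-0) = i := by simp [triX]
      have e2 : triY (j + 1 + 0) (- -1) (-0) = j' := by simp [triY]; omega
      have e3 : triZ (i + 1 + -1) (j + 1 + 0) (- -1) (-0) = k := by simp [triZ]; omega
      refine flip (i + 1) (j + 1) (-1) 0 (by norm_num [IsUnitPair]) (by simp [triX])
        (by simp [triY]) (by simp [triZ]; omega) ?_ ?_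
      · rw [e1, e2, e3]; exact ⟨h.1, h'.2.1, h.2.2⟩
      · rw [e1, e2, e3]; omega
    by_cases c3 : k' = k - 1
    · have e1 : triX (i + 1) (-1) (- -1) = i := by simp [triX]
      have e2 : triY (j + 1 + -1) (-1) (- -1) = j := by simp [triY]
      have e3 : triZ (i + 1) (j + 1 + -1) (-1) (- -1) = k' := by simp [triZ]; omega
      refine flip i (j + 1) 1 (-1) (by norm_num [IsUnitPair]) (by simp [triX]) (by simp [triY])
        (by simp [triZ]; omega) ?_ ?_
      · rw [e1, e2, e3]; exact ⟨h.1, h.2.1, h'.2.2⟩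
      · rw [e1, e2, e3]; omega
    obtain ⟨rfl, rfl, rfl⟩ : i' = i ∧ j' = j ∧ k' = k := by omega
    exact hF

/-- Every point near `z` lies in a lattice triangle that contains `z`. -/
theorem eventually_exists_inTri (n : ℕ) (z : ℂ) : ∀ᶠ w in nhds z, ∃ i j k : ℤ,
    (k = i + j ∨ k = i + j + 1) ∧ InTri n z i j k ∧ InTri n w i j k := by
  have key : ∀ f : ℂ → ℝ, Continuous f → ∀ᶠ w in nhds z, ⌊f w⌋ ≤ f z ∧ f z ≤ ⌊f w⌋ + 1 := by
    intro f hf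
    have h1 : ∀ᶠ w in nhds z, f w < ⌊f z⌋ + 1 :=
      hf.continuousAt.eventually_lt_const (Int.lt_floor_add_one _)
    have h2 : ∀ᶠ w in nhds z, (⌈f z⌉ - 1 : ℝ) < f w :=
      hf.continuousAt.eventually_const_lt (by linarith [Int.ceil_lt_add_one (f z)])
    filter_upwards [h1, h2] with w h1 h2
    have h3 : ⌊f w⌋ < ⌊f z⌋ + 1 := by
      exact_mod_cast (Int.floor_le (f w)).trans_lt h1
    have h4 : ⌈f z⌉ - 1 < ⌊f w⌋ + 1 := by
      exact_mod_cast h2.trans (Int.lt_floor_add_one (f w))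
    have h5 : (⌊f w⌋ : ℝ) ≤ ⌊f z⌋ := by exact_mod_cast (by omega : ⌊f w⌋ ≤ ⌊f z⌋)
    have h6 : (⌈f z⌉ : ℝ) ≤ ⌊f w⌋ + 1 := by exact_mod_cast (by omega : ⌈f z⌉ ≤ ⌊f w⌋ + 1)
    exact ⟨h5.trans (Int.floor_le _), (Int.le_ceil _).trans h6⟩
  filter_upwards [key (cX n) (cX n).continuous, key (cY n) (cY n).continuous,
    key (fun w => cX n w + cY n w) (by fun_prop)] with w h1 h2 h3
  refine ⟨⌊cX n w⌋, ⌊cY n w⌋, ⌊cX n w + cY n w⌋, ?_, ⟨h1, h2, h3⟩,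
    ⟨Int.floor_le _, (Int.lt_floor_add_one _).le⟩, ⟨Int.floor_le _, (Int.lt_floor_add_one _).le⟩,
    Int.floor_le _, (Int.lt_floor_add_one _).le⟩
  have h4 := Int.le_floor_add (cX n w) (cY n w)
  have h5 := Int.le_floor_add_floor (cX n w) (cY n w)
  omega

/-- Off the curve, all lattice triangles that contain `z` are filled as soon as one is, and together
they cover a neighbourhood of `z`. -/
theorem inside_subset_interior (n : ℕ) : inside n ⊆ interior (table n) := by
  rintro z ⟨hz, hz'⟩
  obtain ⟨i, j, k, hF, h⟩ := mem_table.1 hz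
  rw [mem_interior_iff_mem_nhds]
  filter_upwards [eventually_exists_inTri n z] with w ⟨i', j', k', hv, h', hw⟩
  exact mem_table.2 ⟨i', j', k', filled_of_mem_inTri hz' hF h hv h', hw⟩

/-- The part of the plane on the left of the line through an edge is where this is positive. -/
def side (n : ℕ) (a b u v : ℤ) (z : ℂ) : ℝ := u * (cY n z - b) - v * (cX n z - a)

/-- Near an interior point of an edge, the two sides of the edge are in the two triangles. -/
theorem eventually_near_edge {n : ℕ} {a b u v : ℤ} (h : IsUnitPair u v) {q : ℂ} {t : ℝ}
    (ht : 0 < t) (ht' : t < 1) (hx : cX n q = a + t * u) (hy : cY n q = b + t * v) :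
    ∀ᶠ z in nhds q, (0 < side n a b u v z → LeftOf (InOpenTri n z) a b u v) ∧
      (side n a b u v z < 0 → LeftOf (InOpenTri n z) (a + u) (b + v) (-u) (-v)) ∧
      (0 ≤ side n a b u v z → LeftOf (InTri n z) a b u v) ∧
      (side n a b u v z ≤ 0 → LeftOf (InTri n z) (a + u) (b + v) (-u) (-v)) := by
  -- Errors `δ` in both coordinates can add up to `2 * δ` in the coordinate sum, which must stay
  -- below the distances `t` and `1 - t` to the ends.
  obtain ⟨δ, hδ, h1, h2⟩ : ∃ δ : ℝ, 0 < δ ∧ 2 * δ < t ∧ 2 * δ < 1 - t :=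
    ⟨min t (1 - t) / 3, by have : 0 < 1 - t := by linarith
                           positivity,
      by linarith [min_le_left t (1 - t)], by
        have := min_le_right t (1 - t)
        linarith⟩
  have e1 : ∀ᶠ z in nhds q, cX n z < cX n q + δ :=
    (cX n).continuous.continuousAt.eventually_lt_const (by linarith)
  have e2 : ∀ᶠ z in nhds q, cX n q - δ < cX n z :=
    (cX n).continuous.continuousAt.eventually_const_lt (by linarith)
  have e3 : ∀ᶠ z in nhds q, cY n z < cY n q + δ :=
    (cY n).continuous.continuousAt.eventually_lt_const (by linarith)
  have e4 : ∀ᶠ z in nhds q, cY n q - δ < cY n z :=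
    (cY n).continuous.continuousAt.eventually_const_lt (by linarith)
  filter_upwards [e1, e2, e3, e4] with z e1 e2 e3 e4
  rw [hx] at e1 e2
  rw [hy] at e3 e4
  unfold side LeftOf InOpenTri InTri triX triY triZ
  rcases isUnitPair_iff.1 h with
    ⟨rfl, rfl⟩ | ⟨rfl, rfl⟩ | ⟨rfl, rfl⟩ | ⟨rfl, rfl⟩ | ⟨rfl, rfl⟩ | ⟨rfl, rfl⟩ <;>
  · norm_num at e1 e2 e3 e4 ⊢
    refine ⟨fun h => ?_, fun h => ?_, fun h => ?_, fun h => ?_⟩ <;>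
      refine ⟨⟨?_, ?_⟩, ⟨?_, ?_⟩, ?_, ?_⟩ <;> linarith

theorem InOpenTri.mem_interior {n : ℕ} {z : ℂ} {i j k : ℤ} (h : InOpenTri n z i j k)
    (hF : Filled n i j k) : z ∈ interior (table n) := by
  have hopen : IsOpen {w : ℂ | InOpenTri n w i j k} := by
    refine (IsOpen.and ?_ ?_).and ((IsOpen.and ?_ ?_).and (IsOpen.and ?_ ?_)) <;>
      exact isOpen_lt (by fun_prop) (by fun_prop)
  exact _root_.mem_interior.2 ⟨_, fun w hw => mem_table.2 ⟨i, j, k, hF, InOpenTri.inTri hw⟩, hopen, h⟩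

theorem InOpenTri.notMem_table {n : ℕ} {z : ℂ} {i j k : ℤ} (h : InOpenTri n z i j k)
    (hF : ¬ Filled n i j k) : z ∉ table n := by
  intro hz
  obtain ⟨i', j', k', hF', h'⟩ := mem_table.1 hz
  obtain ⟨rfl, rfl, rfl⟩ := h.unique h'
  exact hF hF'

theorem eventually_ray {q w : ℂ} {p : ℂ → Prop} (h : ∀ᶠ z in 𝓝 q, p z) :
    ∀ᶠ r : ℝ in 𝓝[>] 0, p (q + r • w) := by
  have hc : Continuous fun r : ℝ => q + r • w := by fun_prop
  have : Tendsto (fun r : ℝ => q + r • w) (𝓝[>] 0) (𝓝 q) := by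
    have h0 := hc.tendsto 0
    simp only [zero_smul, add_zero] at h0
    exact h0.mono_left nhdsWithin_le_nhds
  exact this.eventually h

theorem side_ray {n : ℕ} {a b u v g h : ℤ} {q : ℂ} {t : ℝ} (hx : cX n q = a + t * u)
    (hy : cY n q = b + t * v) (r : ℝ) :
    side n a b u v (q + r • pt g h) = r * 3 ^ n * ((u * h - v * g : ℤ) : ℝ) := by
  simp only [side, map_add, map_smul, smul_eq_mul, cX_pt, cY_pt, hx, hy]
  push_cast
  ring

/-- A ray that starts on a side and points to the left runs in the interior for a while. -/
theorem eventually_mem_interior {n : ℕ} {a b u v g h : ℤ} (hE : IsBdEdge (Filled n) a b u v)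
    {q : ℂ} {t : ℝ} (ht : 0 < t) (ht' : t < 1) (hx : cX n q = a + t * u) (hy : cY n q = b + t * v)
    (hd : 0 < u * h - v * g) : ∀ᶠ r : ℝ in 𝓝[>] 0, q + r • pt g h ∈ interior (table n) := by
  filter_upwards [eventually_ray (w := pt g h) (eventually_near_edge hE.1 ht ht' hx hy),
    self_mem_nhdsWithin] with r hr hr0
  refine (hr.1 ?_).mem_interior hE.2.1
  rw [side_ray hx hy]
  have : (0 : ℝ) < r := hr0
  have : (0 : ℝ) < ((u * h - v * g : ℤ) : ℝ) := by exact_mod_cast hd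
  positivity

/-- A ray that starts on a side and points to the right leaves the table. -/
theorem eventually_notMem_table {n : ℕ} {a b u v g h : ℤ} (hE : IsBdEdge (Filled n) a b u v)
    {q : ℂ} {t : ℝ} (ht : 0 < t) (ht' : t < 1) (hx : cX n q = a + t * u) (hy : cY n q = b + t * v)
    (hd : u * h - v * g < 0) : ∀ᶠ r : ℝ in 𝓝[>] 0, q + r • pt g h ∉ table n := by
  filter_upwards [eventually_ray (w := pt g h) (eventually_near_edge hE.1 ht ht' hx hy),
    self_mem_nhdsWithin] with r hr hr0
  refine (hr.2.1 ?_).notMem_table hE.2.2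
  rw [side_ray hx hy]
  have h1 : (0 : ℝ) < r := hr0
  have h2 : ((u * h - v * g : ℤ) : ℝ) < 0 := by exact_mod_cast hd
  exact mul_neg_of_pos_of_neg (by positivity) h2

/-- Otherwise the interior would also contain a relatively interior point of a side, and from there
a ray to the right leaves the table at once. -/
theorem notMem_KS_of_mem_interior {n : ℕ} {z : ℂ} (hz : z ∈ interior (table n)) : z ∉ KS n := by
  rintro ⟨s, hs, hzs⟩
  obtain ⟨q, hq, hqs⟩ := mem_closure_iff.1 (segment_subset_closure_openSegment hzs) _
    isOpen_interior hz
  obtain ⟨a, b, u, v, hE, rfl⟩ := mem_sides.1 hs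
  obtain ⟨t, ⟨ht, ht'⟩, hx, hy⟩ := mem_openSegment_edge.1 hqs
  -- The test direction is that of the side turned by `-2π/3`.
  have hd : u * (-u - v) - v * v < 0 := by
    have := hE.1
    unfold IsUnitPair at this
    linarith
  have h1 := eventually_notMem_table hE ht ht' hx hy hd
  have h2 := eventually_ray (w := pt v (-u - v : ℤ)) (mem_interior_iff_mem_nhds.1 hq)
  obtain ⟨r, h1, h2⟩ := (h1.and h2).exists
  exact h1 h2

/-- The open region bounded by `KS_n` is the interior of the table. -/
theorem inside_eq_interior (n : ℕ) : inside n = interior (table n) :=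
  (inside_subset_interior n).antisymm
    fun _ hz => ⟨interior_subset hz, notMem_KS_of_mem_interior hz⟩

theorem inside_mono {m n : ℕ} (h : m ≤ n) : inside m ⊆ inside n := by
  rw [inside_eq_interior, inside_eq_interior]
  exact interior_mono (table_mono h)

/-! ### Reflections and collisions -/

theorem pt_inner (x y x' y' : ℝ) :
    inner ℝ (pt x y) (pt x' y') = x * x' + y * y' + (x * y' + y * x') / 2 := by
  have h : √3 * √3 = 3 := Real.mul_self_sqrt (by norm_num)
  rw [Complex.inner]
  simp [pt, dir_eq]
  linear_combination (y * y' / 4) * h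

theorem pt_ne_zero {u v : ℤ} (h : IsUnitPair u v) : pt u v ≠ 0 := by
  intro h0
  have h1 := pt_inner u v u v
  rw [h0, inner_zero_left] at h1
  have h2 : (u * u + u * v + v * v : ℝ) = 1 := by exact_mod_cast h
  linarith

theorem edge_sub (n : ℕ) (a b u v : ℤ) :
    (edge n a b u v).2 - (edge n a b u v).1 = (1 / 3 ^ n : ℝ) • pt u v := by
  simp only [edge, latPt, pt, Complex.real_smul]
  push_cast
  ring

/-- The bracket is twice the inner product with the unit vector of the edge. The formula has integer
coefficients, so lattice directions are reflected to lattice directions. -/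
theorem reflection_edge {n : ℕ} {a b u v : ℤ} (h : IsUnitPair u v) (x y : ℝ) :
    (Submodule.span ℝ {(edge n a b u v).2 - (edge n a b u v).1}).reflection (pt x y) =
      pt ((2 * u * x + 2 * v * y + u * y + v * x) * u - x)
        ((2 * u * x + 2 * v * y + u * y + v * x) * v - y) := by
  have h1 : (u * u + u * v + v * v : ℝ) = 1 := by exact_mod_cast h
  have h2 : IsUnit (1 / 3 ^ n : ℝ) := by rw [isUnit_iff_ne_zero]; positivity
  simp only [edge_sub, Submodule.span_singleton_smul_eq h2]
  rw [Submodule.reflection_singleton_apply, pt_inner]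
  have h3 : ((‖pt u v‖ : ℝ) ^ 2) = 1 := by
    rw [← real_inner_self_eq_norm_sq, pt_inner]
    linarith
  rw [RCLike.ofReal_real_eq_id, id, h3]
  simp only [pt, nsmul_eq_mul, Complex.real_smul]
  push_cast
  ring

/-- Two lattice edges which meet in a relatively interior point of both are parallel. -/
theorem parallel_of_meet {n : ℕ} {a b u v a' b' u' v' : ℤ} (h : IsUnitPair u v)
    (h' : IsUnitPair u' v') {q : ℂ} (hq : q ∈ openSegment ℝ (edge n a b u v).1 (edge n a b u v).2)
    (hq' : q ∈ openSegment ℝ (edge n a' b' u' v').1 (edge n a' b' u' v').2) :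
    (u' = u ∧ v' = v) ∨ (u' = -u ∧ v' = -v) := by
  obtain ⟨t, -, hx, hy⟩ := mem_openSegment_edge.1 hq
  obtain ⟨t', ⟨h0, h1⟩, hx', hy'⟩ := mem_openSegment_edge.1 hq'
  have key : ((u * (b - b') - v * (a - a') : ℤ) : ℝ) = t' * ((u * v' - v * u' : ℤ) : ℝ) := by
    push_cast
    linear_combination (u : ℝ) * (hy' - hy) - (v : ℝ) * (hx' - hx)
  -- Nonparallel lattice directions have determinant `1` or `-1`, so `key` would make `t'` an
  -- integer.
  have no : ∀ m : ℤ, (m : ℝ) ≠ t' := by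
    intro m hm
    have h2 : (0 : ℝ) < m := hm ▸ h0
    have h3 : (m : ℝ) < 1 := hm ▸ h1
    norm_cast at h2 h3
    omega
  generalize u * (b - b') - v * (a - a') = m at key
  have n1 := no m
  have n2 := no (-m)
  rcases isUnitPair_iff.1 h with
    ⟨rfl, rfl⟩ | ⟨rfl, rfl⟩ | ⟨rfl, rfl⟩ | ⟨rfl, rfl⟩ | ⟨rfl, rfl⟩ | ⟨rfl, rfl⟩ <;>
  rcases isUnitPair_iff.1 h' with
    ⟨rfl, rfl⟩ | ⟨rfl, rfl⟩ | ⟨rfl, rfl⟩ | ⟨rfl, rfl⟩ | ⟨rfl, rfl⟩ | ⟨rfl, rfl⟩ <;>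
  first
  | exact Or.inl ⟨rfl, rfl⟩
  | exact Or.inr ⟨rfl, rfl⟩
  | exact absurd (by norm_num at key; linarith) n1
  | exact absurd (by norm_num at key; push_cast; linarith) n2

/-- Makes the reflection at a collision point independent of the side chosen there, without knowing
that distinct sides are disjoint. -/
theorem span_eq_of_meet {n : ℕ} {s s' : Side} (hs : s ∈ sides n) (hs' : s' ∈ sides n) {q : ℂ}
    (hq : q ∈ openSegment ℝ s.1 s.2) (hq' : q ∈ openSegment ℝ s'.1 s'.2) :
    (Submodule.span ℝ {s.2 - s.1}) = (Submodule.span ℝ {s'.2 - s'.1}) := by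
  obtain ⟨a, b, u, v, hE, rfl⟩ := mem_sides.1 hs
  obtain ⟨a', b', u', v', hE', rfl⟩ := mem_sides.1 hs'
  rw [edge_sub, edge_sub]
  rcases parallel_of_meet hE.1 hE'.1 hq hq' with ⟨rfl, rfl⟩ | ⟨rfl, rfl⟩
  · rfl
  · have : (1 / 3 ^ n : ℝ) • pt (-u : ℤ) (-v : ℤ) = (-1 : ℝ) • ((1 / 3 ^ n : ℝ) • pt u v) := by
      simp only [pt, Complex.real_smul]; push_cast; ring
    have h1 : IsUnit (-1 : ℝ) := isUnit_iff_ne_zero.2 (by norm_num)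
    rw [this, Submodule.span_singleton_smul_eq h1]

theorem mem_KS_of_openSegment {n : ℕ} {s : Side} (hs : s ∈ sides n) {q : ℂ}
    (hq : q ∈ openSegment ℝ s.1 s.2) : q ∈ KS n := ⟨s, hs, openSegment_subset_segment _ _ _ hq⟩

theorem Collision.unique {n : ℕ} {p q q' : Phase} (h : Collision n p q) (h' : Collision n p q') :
    q = q' := by
  obtain ⟨⟨t, ht, hq, hin⟩, s, hs, hqs, hr⟩ := h
  obtain ⟨⟨t', ht', hq', hin'⟩, s', hs', hqs', hr'⟩ := h'
  have e : t = t' := by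
    rcases lt_trichotomy t t' with h | h | h
    · exact absurd (mem_KS_of_openSegment hs hqs) (hq ▸ (hin' t ⟨ht, h⟩).2)
    · exact h
    · exact absurd (mem_KS_of_openSegment hs' hqs') (hq' ▸ (hin t' ⟨ht', h⟩).2)
  have e1 : q.1 = q'.1 := by rw [hq, hq', e]
  refine Prod.ext e1 ?_
  rw [← e1] at hqs'
  rw [hr, hr']
  simp only [span_eq_of_meet hs hs' hqs hqs']

/-- The reflection is invertible, so the incoming directions agree and both basepoints are on one
ray. If they differed, the nearer one, a point of the curve, would lie on the free flight of the
other. -/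
theorem Collision.injective {n : ℕ} {p p' q : Phase} (h : Collision n p q) (h' : Collision n p' q)
    (hp : p.1 ∈ KS n) (hp' : p'.1 ∈ KS n) : p = p' := by
  obtain ⟨⟨t, ht, hq, hin⟩, s, hs, hqs, hr⟩ := h
  obtain ⟨⟨t', ht', hq', hin'⟩, s', hs', hqs', hr'⟩ := h'
  have e2 : p.2 = p'.2 := by
    rw [hr] at hr'
    simp only [span_eq_of_meet hs hs' hqs hqs'] at hr'
    exact (LinearIsometryEquiv.injective _) hr'
  have e : p.1 + t • p.2 = p'.1 + t' • p.2 := by rw [← hq, hq', e2]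
  refine Prod.ext ?_ e2
  rcases lt_trichotomy t t' with h | h | h
  · have : p.1 = p'.1 + (t' - t) • p'.2 := by
      rw [← e2, sub_smul]; linear_combination e
    exact absurd hp (this ▸ (hin' _ ⟨by linarith, by linarith⟩).2)
  · subst h; simpa using e
  · have : p'.1 = p.1 + (t - t') • p.2 := by
      rw [sub_smul]; linear_combination -e
    exact absurd hp' (this ▸ (hin _ ⟨by linarith, by linarith⟩).2)

theorem billiardMap_eq {n : ℕ} {p q : Phase} (h : Collision n p q) : billiardMap n p = some q := by
  have h' : ∃ q, Collision n p q := ⟨q, h⟩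
  rw [billiardMap, dif_pos h', h'.choose_spec.unique h]

/-! ### Lattice phases and periodicity -/

/-- A phase whose basepoint divides a side in the ratio `y : 1 - y` or `1 - y : y` and whose
direction is a multiple of `π / 3` and points into the table. -/
def LatticePhase (n : ℕ) (y : ℝ) (p : Phase) : Prop :=
  ∃ a b u v g h : ℤ, ∃ t : ℝ, IsBdEdge (Filled n) a b u v ∧ (t = y ∨ t = 1 - y) ∧
    (cX n p.1 = a + t * u ∧ cY n p.1 = b + t * v) ∧ IsUnitPair g h ∧ p.2 = pt g h ∧
    0 < u * h - v * g

theorem det_eq_one {u v g h : ℤ} (h1 : IsUnitPair u v) (h2 : IsUnitPair g h)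
    (hd : 0 < u * h - v * g) : u * h - v * g = 1 := by
  rcases isUnitPair_iff.1 h1 with
    ⟨rfl, rfl⟩ | ⟨rfl, rfl⟩ | ⟨rfl, rfl⟩ | ⟨rfl, rfl⟩ | ⟨rfl, rfl⟩ | ⟨rfl, rfl⟩ <;>
  rcases isUnitPair_iff.1 h2 with
    ⟨rfl, rfl⟩ | ⟨rfl, rfl⟩ | ⟨rfl, rfl⟩ | ⟨rfl, rfl⟩ | ⟨rfl, rfl⟩ | ⟨rfl, rfl⟩ <;> omega

/-- The table is bounded, so the ray leaves the interior. At the first exit time the point is in the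
closed table but not in its interior, hence on the curve. -/
theorem exists_first_exit {n : ℕ} {p v : ℂ} (hv : v ≠ 0)
    (h : ∀ᶠ r : ℝ in 𝓝[>] 0, p + r • v ∈ interior (table n)) :
    ∃ t : ℝ, 0 < t ∧ p + t • v ∈ KS n ∧ ∀ r ∈ Set.Ioo 0 t, p + r • v ∈ inside n := by
  obtain ⟨ε, hε, hin⟩ := mem_nhdsGT_iff_exists_Ioo_subset.1 h
  have hε : 0 < ε := hε
  -- The cut-off at `ε / 2` excludes the start, where the ray may be on the boundary.
  set C : Set ℝ := {r | ε / 2 ≤ r ∧ p + r • v ∉ interior (table n)} with hC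
  have hne : C.Nonempty := by
    obtain ⟨R, hR⟩ := (isCompact_table n).isBounded.exists_norm_le
    refine ⟨max (ε / 2) ((|R| + ‖p‖ + 1) / ‖v‖), le_max_left _ _, fun hmem => ?_⟩
    have h1 := hR _ (interior_subset hmem)
    have hv' : 0 < ‖v‖ := norm_pos_iff.2 hv
    set r := max (ε / 2) ((|R| + ‖p‖ + 1) / ‖v‖)
    have h2 : (|R| + ‖p‖ + 1) / ‖v‖ ≤ r := le_max_right _ _
    rw [div_le_iff₀ hv'] at h2
    have h3 : 0 ≤ r := le_trans (by positivity) (le_max_left (ε / 2) _)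
    have h4 : ‖r • v‖ ≤ ‖p + r • v‖ + ‖p‖ := by
      have := norm_sub_le (p + r • v) p
      simpa using this
    rw [norm_smul, Real.norm_of_nonneg h3] at h4
    linarith [le_abs_self R]
  have hbdd : BddBelow C := ⟨ε / 2, fun r hr => hr.1⟩
  have hclosed : IsClosed C := by
    have hc : Continuous fun r : ℝ => p + r • v := by fun_prop
    exact isClosed_Ici.inter (isOpen_interior.preimage hc).isClosed_compl
  have ht := hclosed.csInf_mem hne hbdd
  set t := sInf C
  have hlt : ∀ r ∈ Set.Ioo 0 t, p + r • v ∈ interior (table n) := by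
    rintro r ⟨h0, h1⟩
    by_contra hr
    rcases lt_or_ge r (ε / 2) with h2 | h2
    · exact hr (hin ⟨h0, by linarith⟩)
    · exact (csInf_le hbdd ⟨h2, hr⟩).not_gt h1
  have ht0 : 0 < t := by linarith [ht.1]
  refine ⟨t, ht0, ?_, by rwa [inside_eq_interior]⟩
  by_contra hKS
  have hc : Continuous fun r : ℝ => p + r • v := by fun_prop
  have hmem : p + t • v ∈ table n := by
    refine (isCompact_table n).isClosed.mem_of_tendsto
      (hc.tendsto t |>.mono_left (nhdsWithin_le_nhds (s := Set.Iio t))) ?_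
    filter_upwards [Ioo_mem_nhdsLT ht0] with r hr
    exact interior_subset (hlt r hr)
  exact ht.2 (inside_subset_interior n ⟨hmem, hKS⟩)

theorem LatticePhase.exists_collision {n : ℕ} {y : ℝ} (hy0 : 0 < y) (hy1 : y < 1) {p : Phase}
    (hp : LatticePhase n y p) : ∃ q, Collision n p q ∧ LatticePhase n y q := by
  obtain ⟨a, b, u, v, g, h, t, hE, ht, ⟨hX, hY⟩, hgh, hp2, hd⟩ := hp
  have ht0 : 0 < t ∧ t < 1 := by rcases ht with rfl | rfl <;> constructor <;> linarith
  obtain ⟨τ, hτ, hKS, hin⟩ := exists_first_exit (pt_ne_zero hgh)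
    (eventually_mem_interior hE ht0.1 ht0.2 hX hY hd)
  obtain ⟨a', b', u', v', hE', t', ⟨ht1, ht2⟩, hX', hY'⟩ := mem_KS.1 hKS
  have hd1 := det_eq_one hE.1 hgh hd
  have no : ∀ m : ℤ, (m : ℝ) ≠ y := by
    intro m hm
    have h2 : (0 : ℝ) < m := hm ▸ hy0
    have h3 : (m : ℝ) < 1 := hm ▸ hy1
    norm_cast at h2 h3
    omega
  -- the coordinate transversal to the ray is constant along the ray
  obtain ⟨m, hm⟩ : ∃ m : ℤ, t' * ((u' * h - v' * g : ℤ) : ℝ) = t + m := by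
    refine ⟨g * (b' - b) - h * (a' - a), ?_⟩
    simp only [map_add, map_smul, smul_eq_mul, cX_pt, cY_pt] at hX' hY'
    have hd2 : (u * h - v * g : ℝ) = 1 := by exact_mod_cast hd1
    push_cast
    linear_combination (g : ℝ) * (hY' - hY) - (h : ℝ) * (hX' - hX) + t * hd2
  -- A side parallel to the ray would force `t`, and hence `y`, to be an integer.
  have hDne : u' * h - v' * g ≠ 0 := by
    intro h0
    rw [h0] at hm
    rcases ht with rfl | rfl
    · exact no (-m) (by push_cast at hm ⊢; linarith)
    · exact no (m + 1) (by push_cast at hm ⊢; linarith)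
  have hD : u' * h - v' * g = 1 ∨ u' * h - v' * g = -1 := by
    rcases lt_or_gt_of_ne hDne with h0 | h0
    · right
      have := det_eq_one hE'.1.neg hgh (by linarith)
      linarith
    · left; exact det_eq_one hE'.1 hgh h0
  -- With determinant `1` or `-1`, `hm` gives `t'` as `y` or `-y` up to an integer, which is fixed
  -- by `0 ≤ t' ≤ 1`.
  have htt : t' = y ∨ t' = 1 - y := by
    have : ∃ m : ℤ, t' = y + m ∨ t' = -y + m := by
      rcases hD with hD | hD <;> rw [hD] at hm <;> push_cast at hm <;> rcases ht with rfl | rfl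
      · exact ⟨m, Or.inl (by linarith)⟩
      · exact ⟨m + 1, Or.inr (by push_cast; linarith)⟩
      · exact ⟨-m, Or.inr (by push_cast; linarith)⟩
      · exact ⟨-m - 1, Or.inl (by push_cast; linarith)⟩
    obtain ⟨m, rfl | rfl⟩ := this
    · have h1 : (-1 : ℝ) < m := by linarith
      have h2 : (m : ℝ) < 1 := by linarith
      have : m = 0 := by norm_cast at h2; have : -1 < m := by exact_mod_cast h1
                         omega
      simp [this]
    · have h1 : (0 : ℝ) < m := by linarith
      have h2 : (m : ℝ) < 2 := by linarith
      have : m = 1 := by norm_cast at h1; have : m < 2 := by exact_mod_cast h2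
                         omega
      right; rw [this]; push_cast; ring
  have ht1' : 0 < t' ∧ t' < 1 := by rcases htt with rfl | rfl <;> constructor <;> linarith
  -- A ray that arrives from the right of the side would be outside the table just before the
  -- collision.
  have hneg : u' * h - v' * g < 0 := by
    by_contra hcon
    have hpos : 0 < u' * h - v' * g := by omega
    have h1 := eventually_notMem_table hE' ht1'.1 ht1'.2 hX' hY' (g := -g) (h := -h) (by linarith)
    have h2 : ∀ᶠ r : ℝ in 𝓝[>] 0, r < τ :=
      nhdsWithin_le_nhds (eventually_lt_nhds hτ)
    obtain ⟨r, ⟨h1, h2⟩, h3⟩ := ((h1.and h2).and self_mem_nhdsWithin).exists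
    have h3 : 0 < r := h3
    apply h1
    have h4 := (hin (τ - r) ⟨by linarith, by linarith⟩).1
    convert h4 using 1
    simp only [pt, Complex.real_smul]
    push_cast
    ring
  set M : ℤ := 2 * u' * g + 2 * v' * h + u' * h + v' * g with hM
  refine ⟨(p.1 + τ • p.2, pt (M * u' - g : ℤ) (M * v' - h : ℤ)),
    ⟨⟨τ, hτ, rfl, by rwa [hp2]⟩, edge n a' b' u' v', mem_sides.2 ⟨_, _, _, _, hE', rfl⟩,
      mem_openSegment_edge.2 ⟨t', ht1', by rwa [hp2], by rwa [hp2]⟩, ?_⟩,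
    a', b', u', v', M * u' - g, M * v' - h, t', hE', htt, ⟨by rwa [hp2], by rwa [hp2]⟩, ?_, rfl, ?_⟩
  · rw [hp2, reflection_edge hE'.1]
    push_cast [hM]
    rfl
  · have h1 := hE'.1
    unfold IsUnitPair at *
    linear_combination M * M * h1 + hgh - M * hM
  · linarith

theorem LatticePhase.mem_KS {n : ℕ} {y : ℝ} (hy0 : 0 < y) (hy1 : y < 1) {p : Phase}
    (hp : LatticePhase n y p) : p.1 ∈ KS n := by
  obtain ⟨a, b, u, v, g, h, t, hE, ht, hc, -⟩ := hp
  refine KochBilliard.mem_KS.2 ⟨a, b, u, v, hE, t, ?_, hc⟩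
  rcases ht with rfl | rfl <;> constructor <;> linarith

theorem finite_latticePhase (n : ℕ) (y : ℝ) : {p | LatticePhase n y p}.Finite := by
  have hW : {w : ℂ | ∃ g h : ℤ, IsUnitPair g h ∧ w = pt g h}.Finite := by
    refine (Set.toFinite {pt (1 : ℤ) (0 : ℤ), pt (0 : ℤ) (1 : ℤ), pt (-1 : ℤ) (1 : ℤ),
      pt (-1 : ℤ) (0 : ℤ), pt (0 : ℤ) (-1 : ℤ), pt (1 : ℤ) (-1 : ℤ)}).subset ?_
    rintro w ⟨g, h, hgh, rfl⟩
    rcases isUnitPair_iff.1 hgh with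
      ⟨rfl, rfl⟩ | ⟨rfl, rfl⟩ | ⟨rfl, rfl⟩ | ⟨rfl, rfl⟩ | ⟨rfl, rfl⟩ | ⟨rfl, rfl⟩ <;> simp
  refine (((List.finite_toSet (sides n)).prod (Set.toFinite {y, 1 - y})).prod hW |>.image
    fun x : (Side × ℝ) × ℂ => (x.1.1.1 + x.1.2 • (x.1.1.2 - x.1.1.1), x.2)).subset ?_
  rintro ⟨p, w⟩ ⟨a, b, u, v, g, h, t, hE, ht, hc, hgh, hw, -⟩
  exact ⟨((edge n a b u v, t), w), ⟨⟨mem_sides.2 ⟨_, _, _, _, hE, rfl⟩, ht⟩, g, h, hgh, hw⟩,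
    Prod.ext (eq_edge_point_iff.2 hc).symm rfl⟩

theorem LatticePhase.orbit {n : ℕ} {y : ℝ} (hy0 : 0 < y) (hy1 : y < 1) {p : Phase}
    (hp : LatticePhase n y p) (k : ℕ) :
    ∃ q, KochBilliard.orbit n p k = some q ∧ LatticePhase n y q := by
  induction k with
  | zero => exact ⟨p, rfl, hp⟩
  | succ k ih =>
    obtain ⟨q, hq, hq'⟩ := ih
    obtain ⟨r, hr, hr'⟩ := hq'.exists_collision hy0 hy1
    exact ⟨r, by rw [KochBilliard.orbit, hq, Option.bind_some, billiardMap_eq hr], hr'⟩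

/-- An injective self-map of a finite set has only periodic points. -/
theorem LatticePhase.isPeriodic {n : ℕ} {y : ℝ} (hy0 : 0 < y) (hy1 : y < 1) {p : Phase}
    (hp : LatticePhase n y p) : IsPeriodic n p := by
  have : Finite {p // LatticePhase n y p} := (finite_latticePhase n y).to_subtype
  choose f hf hf' using fun q : {p // LatticePhase n y p} => q.2.exists_collision hy0 hy1
  let F : {p // LatticePhase n y p} → {p // LatticePhase n y p} := fun q => ⟨f q, hf' q⟩
  have hF : Function.Injective F := by
    intro q q' h
    have h1 : f q = f q' := congrArg Subtype.val h
    exact Subtype.ext ((hf q).injective (h1 ▸ hf q') (q.2.mem_KS hy0 hy1) (q'.2.mem_KS hy0 hy1))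
  have horb : ∀ k, KochBilliard.orbit n p k = some (F^[k] ⟨p, hp⟩).1 := by
    intro k
    induction k with
    | zero => rfl
    | succ k ih =>
      rw [KochBilliard.orbit, ih, Option.bind_some, Function.iterate_succ_apply']
      exact billiardMap_eq (hf _)
  obtain ⟨T, hT, hT'⟩ := hF.mem_periodicPts ⟨p, hp⟩
  refine ⟨T, hT, ?_⟩
  rw [horb, hT'.eq]

/-! ### Ternary expansions -/

theorem ofDigits_eq_div_three (e : ℕ → Fin 3) :
    Real.ofDigits e = ((e 0 : ℕ) + Real.ofDigits (leftShift e)) / 3 := by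
  rw [Real.ofDigits_eq_sum_add_ofDigits e 1]
  have h : leftShift e = fun i => e (i + 1) := rfl
  simp only [Finset.range_one, Finset.sum_singleton, Real.ofDigitsTerm, h]
  push_cast
  ring

theorem leftShift_iterate (d : ℕ → Fin 3) (n i : ℕ) : (leftShift^[n] d) i = d (i + n) := by
  induction n generalizing i with
  | zero => rfl
  | succ n ih =>
    rw [Function.iterate_succ_apply', leftShift, ih]
    congr 1
    omega

/-- An orbit meets sides at ratio `y` and at ratio `1 - y`; complementing the digits swaps `0` and
`2` and fixes `1`, so both ratios are treated alike. -/
theorem ofDigits_rev (e : ℕ → Fin 3) :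
    Real.ofDigits (fun i => Fin.rev (e i)) = 1 - Real.ofDigits e := by
  have h1 := Real.ofDigits_const_last_eq_one 2
  rw [eq_sub_iff_add_eq, ← h1, Real.ofDigits, Real.ofDigits, Real.ofDigits,
    ← Real.summable_ofDigitsTerm.tsum_add Real.summable_ofDigitsTerm]
  congr 1
  ext i
  simp only [Real.ofDigitsTerm, ← add_mul]
  congr 1
  have : ∀ c : Fin 3, ((Fin.rev c : ℕ) + (c : ℕ)) = 2 := by decide
  have h := this (e i)
  simp only [Fin.val_last]
  exact_mod_cast h

theorem ofDigits_pos {e : ℕ → Fin 3} {i : ℕ} (h : e i ≠ 0) : 0 < Real.ofDigits e := by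
  refine Real.summable_ofDigitsTerm.tsum_pos (fun _ => Real.ofDigitsTerm_nonneg) i ?_
  have : 0 < (e i : ℕ) := Nat.pos_of_ne_zero fun h0 => h (Fin.ext h0)
  have h' : (0 : ℝ) < (e i : ℕ) := by exact_mod_cast this
  unfold Real.ofDigitsTerm
  positivity

theorem ofDigits_lt_one {e : ℕ → Fin 3} {i : ℕ} (h : e i ≠ 2) : Real.ofDigits e < 1 := by
  have h1 : ∀ c : Fin 3, c ≠ 2 → Fin.rev c ≠ 0 := by decide
  have := ofDigits_pos (e := fun i => Fin.rev (e i)) (h1 _ h)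
  rw [ofDigits_rev] at this
  linarith

/-! ### Points of a side at later levels; persistence of orbits -/

/-- A point in the middle third of a side gets into the interior of the table. -/
theorem middle_third_mem_inside {n : ℕ} {a b u v : ℤ} (hE : IsBdEdge (Filled n) a b u v) {q : ℂ}
    {t : ℝ} (ht : 0 < t) (ht' : t < 1) (hx : cX n q = a + (1 + t) / 3 * u)
    (hy : cY n q = b + (1 + t) / 3 * v) : q ∈ inside (n + 1) := by
  rw [inside_eq_interior, mem_interior_iff_mem_nhds]
  -- At the next level both triangles at the middle third are filled: a part of the old triangle and
  -- the cell.
  have hl : LeftOf (Filled (n + 1)) (3 * a + 1 * u) (3 * b + 1 * v) u v :=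
    grow_of_parent (triangle_valid hE.1) (triangle_parent hE.1 (by simp) (by simp)) hE.2.1
  have hr : LeftOf (Filled (n + 1)) (3 * a + 1 * u + u) (3 * b + 1 * v + v) (-u) (-v) := by
    obtain ⟨e1, e2, e3⟩ := cell_eq_right (a := a) (b := b) hE.1
    have h := hE.grow_cell
    unfold LeftOf at h ⊢
    rw [← e1, ← e2, ← e3] at h
    rw [show 3 * a + 1 * u + u = 3 * a + 2 * u by ring,
      show 3 * b + 1 * v + v = 3 * b + 2 * v by ring]
    exact h
  have hnear := eventually_near_edge (n := n + 1) (a := 3 * a + 1 * u) (b := 3 * b + 1 * v)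
    hE.1 ht ht' (q := q) (by rw [cX_succ, hx]; push_cast; ring)
    (by rw [cY_succ, hy]; push_cast; ring)
  filter_upwards [hnear] with z hz
  rcases le_total 0 (side (n + 1) (3 * a + 1 * u) (3 * b + 1 * v) u v z) with h | h
  · exact mem_table.2 ⟨_, _, _, hl, hz.2.2.1 h⟩
  · exact mem_table.2 ⟨_, _, _, hr, hz.2.2.2 h⟩

/-- A point of a side whose first ternary digit is not `1` stays on a parallel side. -/
theorem outer_third {n : ℕ} {a b u v : ℤ} (hE : IsBdEdge (Filled n) a b u v) {q : ℂ}
    {e : ℕ → Fin 3} (he : e 0 ≠ 1) (hx : cX n q = a + Real.ofDigits e * u)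
    (hy : cY n q = b + Real.ofDigits e * v) :
    ∃ a' b', IsBdEdge (Filled (n + 1)) a' b' u v ∧
      cX (n + 1) q = a' + Real.ofDigits (leftShift e) * u ∧
      cY (n + 1) q = b' + Real.ofDigits (leftShift e) * v := by
  rw [cX_succ, cY_succ, hx, hy, ofDigits_eq_div_three e]
  rcases (by omega : e 0 = 0 ∨ e 0 = 2) with h | h <;> rw [h]
  · refine ⟨3 * a, 3 * b, isBdEdge_grow.2 ⟨a, b, u, v, hE, Or.inl ⟨rfl, rfl, rfl, rfl⟩⟩, ?_, ?_⟩ <;>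
    · push_cast [Fin.val_zero]; ring
  · refine ⟨3 * a + 2 * u, 3 * b + 2 * v, isBdEdge_grow.2
      ⟨a, b, u, v, hE, Or.inr (Or.inr (Or.inr ⟨rfl, rfl, rfl, rfl⟩))⟩, ?_, ?_⟩ <;>
    · push_cast [Fin.val_two]; ring

/-- A point of a side which has no ternary digit `1` stays on a parallel side for ever. -/
theorem cantor_point {n : ℕ} {a b u v : ℤ} (hE : IsBdEdge (Filled n) a b u v) {q : ℂ}
    {e : ℕ → Fin 3} (he : ∀ i, e i ≠ 1) (hx : cX n q = a + Real.ofDigits e * u)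
    (hy : cY n q = b + Real.ofDigits e * v) (k : ℕ) :
    ∃ a' b', IsBdEdge (Filled (n + k)) a' b' u v ∧
      cX (n + k) q = a' + Real.ofDigits (leftShift^[k] e) * u ∧
      cY (n + k) q = b' + Real.ofDigits (leftShift^[k] e) * v := by
  induction k with
  | zero => exact ⟨a, b, hE, hx, hy⟩
  | succ k ih =>
    obtain ⟨a', b', hE', hx', hy'⟩ := ih
    rw [Function.iterate_succ_apply', ← add_assoc]
    exact outer_third hE' (by rw [leftShift_iterate]; exact he _) hx' hy'

theorem span_edge (n : ℕ) (a b u v : ℤ) :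
    Submodule.span ℝ {(edge n a b u v).2 - (edge n a b u v).1} = Submodule.span ℝ {pt u v} := by
  have h : IsUnit (1 / 3 ^ n : ℝ) := by rw [isUnit_iff_ne_zero]; positivity
  rw [edge_sub, Submodule.span_singleton_smul_eq h]

/-- Collisions at points without ternary digit `1` persist. -/
theorem Collision.persist {n : ℕ} {e : ℕ → Fin 3} (he : ∀ i, e i ≠ 1)
    (he0 : ∀ k, ∃ i, e (i + k) = 0) (he2 : ∀ k, ∃ i, e (i + k) = 2) {p q : Phase}
    (h : Collision n p q) (hq : LatticePhase n (Real.ofDigits e) q) (k : ℕ) :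
    Collision (n + k) p q := by
  obtain ⟨⟨t, ht, hqt, hin⟩, s, hs, hqs, hr⟩ := h
  obtain ⟨a, b, u, v, g, h, y, hE, hy, ⟨hX, hY⟩, -⟩ := hq
  obtain ⟨e', he', hy', hk⟩ : ∃ e' : ℕ → Fin 3, (∀ i, e' i ≠ 1) ∧ y = Real.ofDigits e' ∧
      ∀ k, 0 < Real.ofDigits (leftShift^[k] e') ∧ Real.ofDigits (leftShift^[k] e') < 1 := by
    have unit_interval : ∀ {e' : ℕ → Fin 3} (k : ℕ), (∃ i, e' (i + k) = 0) →
        (∃ i, e' (i + k) = 2) →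
        0 < Real.ofDigits (leftShift^[k] e') ∧ Real.ofDigits (leftShift^[k] e') < 1 := by
      rintro e' k ⟨i, hi⟩ ⟨j, hj⟩
      refine ⟨ofDigits_pos (i := j) ?_, ofDigits_lt_one (i := i) ?_⟩ <;> rw [leftShift_iterate]
      · rw [hj]; decide
      · rw [hi]; decide
    rcases hy with rfl | rfl
    · exact ⟨e, he, rfl, fun k => unit_interval k (he0 k) (he2 k)⟩
    · have h1 : ∀ c : Fin 3, c ≠ 1 → Fin.rev c ≠ 1 := by decide
      refine ⟨fun i => Fin.rev (e i), fun i => h1 _ (he i), (ofDigits_rev e).symm,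
        fun k => unit_interval k ?_ ?_⟩
      · obtain ⟨i, hi⟩ := he2 k
        exact ⟨i, by simp only [hi]; decide⟩
      · obtain ⟨i, hi⟩ := he0 k
        exact ⟨i, by simp only [hi]; decide⟩
  subst hy'
  obtain ⟨a', b', hE', hX', hY'⟩ := cantor_point hE he' hX hY k
  -- The flight stays inside the larger region, and the end point is still a relatively interior
  -- point of a side of the same direction, so the reflection is the same.
  refine ⟨⟨t, ht, hqt, fun r hr => inside_mono (Nat.le_add_right n k) (hin r hr)⟩,
    edge (n + k) a' b' u v, mem_sides.2 ⟨_, _, _, _, hE', rfl⟩,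
    mem_openSegment_edge.2 ⟨_, hk k, hX', hY'⟩, ?_⟩
  have e1 := span_eq_of_meet hs (mem_sides.2 ⟨_, _, _, _, hE, rfl⟩) hqs
    (mem_openSegment_edge.2 ⟨_, hk 0, hX, hY⟩)
  rw [hr]
  simp only [e1, span_edge]

theorem orbit_persist {n : ℕ} {e : ℕ → Fin 3} (he : ∀ i, e i ≠ 1)
    (he0 : ∀ k, ∃ i, e (i + k) = 0) (he2 : ∀ k, ∃ i, e (i + k) = 2) {p : Phase}
    (hp : LatticePhase n (Real.ofDigits e) p) (k : ℕ) : orbit (n + k) p = orbit n p := by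
  have hy0 : 0 < Real.ofDigits e := by
    obtain ⟨i, hi⟩ := he2 0
    exact ofDigits_pos (i := i) (by rw [add_zero] at hi; rw [hi]; decide)
  have hy1 : Real.ofDigits e < 1 := by
    obtain ⟨i, hi⟩ := he0 0
    exact ofDigits_lt_one (i := i) (by rw [add_zero] at hi; rw [hi]; decide)
  funext j
  induction j with
  | zero => rfl
  | succ j ih =>
    obtain ⟨q, hq, hq'⟩ := hp.orbit hy0 hy1 j
    obtain ⟨r, hr, hr'⟩ := hq'.exists_collision hy0 hy1
    rw [orbit, orbit, ih, hq, Option.bind_some, Option.bind_some, billiardMap_eq hr,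
      billiardMap_eq (hr.persist he he0 he2 hr' k)]

/-! ### The compatible sequence -/

theorem dir_eq_pt : dir = pt (0 : ℤ) (1 : ℤ) := by simp [pt]

/-- The integer coordinates (initial point and direction) of the side of `KS_n` which contains the
compatible point of the point with digits `d`. -/
def compatibleEdge (d : ℕ → Fin 3) : ℕ → ℤ × ℤ × ℤ × ℤ
  | 0 => (0, 0, 1, 0)
  | n + 1 =>
    let (a, b, u, v) := compatibleEdge d n
    if d n = 0 then (3 * a, 3 * b, u, v)
    else if d n = 2 then (3 * a + 2 * u, 3 * b + 2 * v, u, v)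
    -- For the digit `c`: one of the two free sides of the cell is parallel to `dir`, and the
    -- backward ray leaves the cell through the other.
    else if v = 0 then (3 * a + u, 3 * b + v, u + v, -u)
    else (3 * a + 2 * u + v, 3 * b + v - u, -v, u + v)

/-- The side of `KS_n` which contains the compatible point of the point with digits `d`. -/
def compatibleSide (d : ℕ → Fin 3) (n : ℕ) : Side :=
  edge n (compatibleEdge d n).1 (compatibleEdge d n).2.1 (compatibleEdge d n).2.2.1
    (compatibleEdge d n).2.2.2

/-- The compatible sequence of the point with digits `d`. -/
def compatiblePoint (d : ℕ → Fin 3) (n : ℕ) : ℂ :=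
  (compatibleSide d n).1 +
    Real.ofDigits (leftShift^[n] d) • ((compatibleSide d n).2 - (compatibleSide d n).1)

theorem compatiblePoint_coord {d : ℕ → Fin 3} {n : ℕ} {a b u v : ℤ}
    (h : compatibleEdge d n = (a, b, u, v)) :
    cX n (compatiblePoint d n) = a + Real.ofDigits (leftShift^[n] d) * u ∧
      cY n (compatiblePoint d n) = b + Real.ofDigits (leftShift^[n] d) * v := by
  apply eq_edge_point_iff.1
  rw [compatiblePoint, compatibleSide, h]

/-- Only the side directions `1` and `1 - ω` occur. With both of them `dir` has determinant `1`, so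
it points into the table. -/
theorem compatibleEdge_spec (d : ℕ → Fin 3) (n : ℕ) : ∃ a b u v,
    compatibleEdge d n = (a, b, u, v) ∧ IsBdEdge (Filled n) a b u v ∧ u = 1 ∧ (v = 0 ∨ v = -1) := by
  induction n with
  | zero => exact ⟨0, 0, 1, 0, rfl, isBdEdge_zero.2 (by simp), rfl, by simp⟩
  | succ n ih =>
    obtain ⟨a, b, u, v, he, hE, hu, hv⟩ := ih
    rw [compatibleEdge, he]
    dsimp only
    split_ifs with h0 h2 h3
    · exact ⟨_, _, _, _, rfl, isBdEdge_grow.2 ⟨a, b, u, v, hE, Or.inl ⟨rfl, rfl, rfl, rfl⟩⟩, hu, hv⟩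
    · exact ⟨_, _, _, _, rfl, isBdEdge_grow.2
        ⟨a, b, u, v, hE, Or.inr (Or.inr (Or.inr ⟨rfl, rfl, rfl, rfl⟩))⟩, hu, hv⟩
    · exact ⟨_, _, _, _, rfl, isBdEdge_grow.2
        ⟨a, b, u, v, hE, Or.inr (Or.inl ⟨rfl, rfl, rfl, rfl⟩)⟩, by omega, by omega⟩
    · exact ⟨_, _, _, _, rfl, isBdEdge_grow.2
        ⟨a, b, u, v, hE, Or.inr (Or.inr (Or.inl ⟨rfl, rfl, rfl, rfl⟩))⟩, by omega, by omega⟩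

theorem compatiblePoint_succ_of_ne_one {d : ℕ → Fin 3} {n : ℕ} (h : d n ≠ 1) :
    compatiblePoint d (n + 1) = compatiblePoint d n := by
  obtain ⟨a, b, u, v, he, -⟩ := compatibleEdge_spec d n
  obtain ⟨hx, hy⟩ := compatiblePoint_coord he
  rw [ofDigits_eq_div_three, ← Function.iterate_succ_apply' leftShift, leftShift_iterate,
    zero_add] at hx hy
  have hn : compatibleEdge d (n + 1) = if d n = 0 then (3 * a, 3 * b, u, v)
      else (3 * a + 2 * u, 3 * b + 2 * v, u, v) := by
    rw [compatibleEdge, he]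
    dsimp only
    split_ifs with h1 h2 <;> first | rfl | omega
  rcases (by omega : d n = 0 ∨ d n = 2) with h0 | h0
  · rw [if_pos h0] at hn
    obtain ⟨hx', hy'⟩ := compatiblePoint_coord hn
    apply ext_coord (n := n + 1)
    · rw [hx', cX_succ, hx, h0]; push_cast [Fin.val_zero]; ring
    · rw [hy', cY_succ, hy, h0]; push_cast [Fin.val_zero]; ring
  · rw [if_neg (by rw [h0]; decide)] at hn
    obtain ⟨hx', hy'⟩ := compatiblePoint_coord hn
    apply ext_coord (n := n + 1)
    · rw [hx', cX_succ, hx, h0]; push_cast [Fin.val_two]; ring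
    · rw [hy', cY_succ, hy, h0]; push_cast [Fin.val_two]; ring

theorem compatiblePoint_mem_inside {d : ℕ → Fin 3} {n : ℕ} (h : d n = 1)
    (h0 : 0 < Real.ofDigits (leftShift^[n + 1] d)) (h1 : Real.ofDigits (leftShift^[n + 1] d) < 1) :
    compatiblePoint d n ∈ inside (n + 1) := by
  obtain ⟨a, b, u, v, he, hE, -⟩ := compatibleEdge_spec d n
  obtain ⟨hx, hy⟩ := compatiblePoint_coord he
  rw [ofDigits_eq_div_three, ← Function.iterate_succ_apply' leftShift, leftShift_iterate,
    zero_add, h] at hx hy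
  refine middle_third_mem_inside hE h0 h1 ?_ ?_
  · rw [hx]; push_cast [Fin.val_one]; ring
  · rw [hy]; push_cast [Fin.val_one]; ring

/-- The ray from the next compatible point crosses a cell. -/
theorem compatiblePoint_succ_of_eq_one {d : ℕ → Fin 3} {n : ℕ} (h : d n = 1)
    (h0 : 0 < Real.ofDigits (leftShift^[n + 1] d)) (h1 : Real.ofDigits (leftShift^[n + 1] d) < 1) :
    ∃ τ : ℝ, 0 < τ ∧ compatiblePoint d n = compatiblePoint d (n + 1) + τ • dir ∧
      ∀ r ∈ Set.Ioo 0 τ, compatiblePoint d (n + 1) + r • dir ∈ inside (n + 1) := by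
  obtain ⟨a, b, u, v, he, hE, rfl, hv⟩ := compatibleEdge_spec d n
  obtain ⟨hx, hy⟩ := compatiblePoint_coord he
  rw [ofDigits_eq_div_three, ← Function.iterate_succ_apply' leftShift, leftShift_iterate,
    zero_add, h] at hx hy
  have hn : compatibleEdge d (n + 1) = if v = 0 then (3 * a + 1, 3 * b + v, 1 + v, -1)
      else (3 * a + 2 * 1 + v, 3 * b + v - 1, -v, 1 + v) := by
    rw [compatibleEdge, he]
    dsimp only
    rw [if_neg (by rw [h]; decide), if_neg (by rw [h]; decide)]
  have hcoord : ∀ {a b u v : ℤ}, compatibleEdge d (n + 1) = (a, b, u, v) →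
      cX (n + 1) (compatiblePoint d (n + 1)) = a + Real.ofDigits (leftShift^[n + 1] d) * u ∧
      cY (n + 1) (compatiblePoint d (n + 1)) = b + Real.ofDigits (leftShift^[n + 1] d) * v :=
    compatiblePoint_coord
  generalize Real.ofDigits (leftShift^[n + 1] d) = t at h0 h1 hx hy hcoord
  have h3 : (0 : ℝ) < 3 ^ (n + 1) := by positivity
  have hcX : ∀ (z : ℂ) (r : ℝ), cX (n + 1) (z + r • dir) = cX (n + 1) z := by
    intro z r
    rw [dir_eq_pt, map_add, map_smul, cX_pt]; simp
  have hcY : ∀ (z : ℂ) (r : ℝ), cY (n + 1) (z + r • dir) = cY (n + 1) z + r * 3 ^ (n + 1) := by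
    intro z r
    rw [dir_eq_pt, map_add, map_smul, cY_pt]; simp
  have hcell := hE.grow_cell
  rw [inside_eq_interior]
  rcases hv with rfl | rfl
  · rw [if_pos rfl] at hn
    obtain ⟨hx', hy'⟩ := hcoord hn
    -- The ray runs along a chord of the cell parallel to its side from the apex to the right; the
    -- chord has length `t` times the side of the cell.
    refine ⟨t / 3 ^ (n + 1), by positivity, ?_, ?_⟩
    · apply ext_coord (n := n + 1)
      · rw [hcX, cX_succ, hx, hx']; push_cast [Fin.val_one]; ring
      · rw [hcY, cY_succ, hy, hy', div_mul_cancel₀ _ h3.ne']; push_cast [Fin.val_one]; ring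
    · rintro r ⟨hr0, hr1⟩
      rw [lt_div_iff₀ h3] at hr1
      have hr0 : 0 < r * 3 ^ (n + 1) := by positivity
      refine InOpenTri.mem_interior ?_ hcell
      unfold InOpenTri
      rw [hcX, hcY, hx', hy']
      unfold triX triY triZ
      norm_num
      refine ⟨⟨?_, ?_⟩, ⟨?_, ?_⟩, ?_, ?_⟩ <;> linarith
  · rw [if_neg (by decide)] at hn
    obtain ⟨hx', hy'⟩ := hcoord hn
    have ht : 0 < 1 - t := by linarith
    -- Here the chord is parallel to the other free side and starts at ratio `t` from the apex,
    -- which leaves the factor `1 - t`.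
    refine ⟨(1 - t) / 3 ^ (n + 1), by positivity, ?_, ?_⟩
    · apply ext_coord (n := n + 1)
      · rw [hcX, cX_succ, hx, hx']; push_cast [Fin.val_one]; ring
      · rw [hcY, cY_succ, hy, hy', div_mul_cancel₀ _ h3.ne']; push_cast [Fin.val_one]; ring
    · rintro r ⟨hr0, hr1⟩
      rw [lt_div_iff₀ h3] at hr1
      have hr0 : 0 < r * 3 ^ (n + 1) := by positivity
      refine InOpenTri.mem_interior ?_ hcell
      unfold InOpenTri
      rw [hcX, hcY, hx', hy']
      unfold triX triY triZ
      norm_num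
      refine ⟨⟨?_, ?_⟩, ⟨?_, ?_⟩, ?_, ?_⟩ <;> linarith

/-- The chords all have direction `dir` and join up, and each joint has become interior. The last
alternative serves both the uniqueness of the sequence and the exactness of `N`. -/
theorem compatiblePoint_ray {d : ℕ → Fin 3}
    (h01 : ∀ n, 0 < Real.ofDigits (leftShift^[n] d) ∧ Real.ofDigits (leftShift^[n] d) < 1)
    {m n : ℕ} (hmn : m ≤ n) : ∃ T : ℝ, 0 ≤ T ∧
      compatiblePoint d m = compatiblePoint d n + T • dir ∧
      (∀ r ∈ Set.Ioo 0 T, compatiblePoint d n + r • dir ∈ inside n) ∧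
      (T = 0 ∨ compatiblePoint d m ∈ inside n) := by
  induction n, hmn using Nat.le_induction with
  | base => exact ⟨0, le_rfl, by simp, by simp, Or.inl rfl⟩
  | succ n hmn ih =>
    obtain ⟨T, hT, hx, hin, hor⟩ := ih
    by_cases hd : d n = 1
    · have hmem := compatiblePoint_mem_inside hd (h01 _).1 (h01 _).2
      obtain ⟨τ, hτ, hx', hin'⟩ := compatiblePoint_succ_of_eq_one hd (h01 _).1 (h01 _).2
      refine ⟨τ + T, by linarith, by rw [hx, hx', add_smul, add_assoc], ?_, Or.inr ?_⟩
      · rintro r ⟨hr0, hr1⟩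
        rcases lt_trichotomy r τ with h | h | h
        · exact hin' r ⟨hr0, h⟩
        · rw [h, ← hx']; exact hmem
        · have := inside_mono n.le_succ (hin (r - τ) ⟨by linarith, by linarith⟩)
          rwa [hx', add_assoc, ← add_smul, add_sub_cancel] at this
      · rcases hor with rfl | h
        · rw [hx, zero_smul, add_zero]; exact hmem
        · exact inside_mono n.le_succ h
    · rw [compatiblePoint_succ_of_ne_one hd]
      exact ⟨T, hT, hx, fun r hr => inside_mono n.le_succ (hin r hr),
        hor.imp_right fun h => inside_mono n.le_succ h⟩

theorem latticePhase_compatiblePoint (d : ℕ → Fin 3) (n : ℕ) :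
    LatticePhase n (Real.ofDigits (leftShift^[n] d)) (compatiblePoint d n, dir) := by
  obtain ⟨a, b, u, v, he, hE, rfl, hv⟩ := compatibleEdge_spec d n
  exact ⟨a, b, 1, v, 0, 1, _, hE, Or.inl rfl, compatiblePoint_coord he, by norm_num [IsUnitPair],
    dir_eq_pt, by norm_num⟩

theorem compatiblePoint_zero (d : ℕ → Fin 3) :
    compatiblePoint d 0 = ((Real.ofDigits d : ℝ) : ℂ) := by
  simp [compatiblePoint, compatibleSide, compatibleEdge, edge, latPt, pt]

theorem isCompatibleSeq_compatiblePoint {d : ℕ → Fin 3}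
    (h01 : ∀ n, 0 < Real.ofDigits (leftShift^[n] d) ∧ Real.ofDigits (leftShift^[n] d) < 1) :
    IsCompatibleSeq dir ((Real.ofDigits d : ℝ) : ℂ) (compatiblePoint d) := by
  refine ⟨compatiblePoint_zero d, fun n => ?_⟩
  obtain ⟨T, hT, hx, hin, -⟩ := compatiblePoint_ray h01 n.zero_le
  obtain ⟨a, b, u, v, he, hE, rfl, hv⟩ := compatibleEdge_spec d n
  obtain ⟨hX, hY⟩ := compatiblePoint_coord he
  refine ⟨(latticePhase_compatiblePoint d n).mem_KS (h01 n).1 (h01 n).2, ?_, T, hT,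
    by rw [← compatiblePoint_zero, hx], hin⟩
  obtain ⟨ε, hε, h⟩ := mem_nhdsGT_iff_exists_Ioo_subset.1
    (eventually_mem_interior hE (h01 n).1 (h01 n).2 hX hY (g := 0) (h := 1) (by norm_num))
  refine ⟨ε, hε, fun r hr => ?_⟩
  rw [inside_eq_interior, dir_eq_pt]
  exact h hr

theorem IsCompatibleSeq.eq_compatiblePoint {d : ℕ → Fin 3}
    (h01 : ∀ n, 0 < Real.ofDigits (leftShift^[n] d) ∧ Real.ofDigits (leftShift^[n] d) < 1)
    {y : ℕ → ℂ} (hy : IsCompatibleSeq dir ((Real.ofDigits d : ℝ) : ℂ) y) :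
    y = compatiblePoint d := by
  funext n
  obtain ⟨T, hT, hx, hin, hor⟩ := compatiblePoint_ray h01 n.zero_le
  obtain ⟨hKS, -, t, ht, hyt, hyin⟩ := hy.2 n
  rw [← compatiblePoint_zero] at hyt
  have e : y n + t • dir = compatiblePoint d n + T • dir := by rw [← hyt, hx]
  rcases lt_trichotomy t T with h | h | h
  -- The other candidate would lie on the open segment from the compatible point to the start, or be
  -- the start itself, which has become interior.
  · exfalso
    rcases ht.eq_or_lt with rfl | ht
    · rw [zero_smul, add_zero] at hyt
      rcases hor with h' | h'
      · exact h.ne h'.symm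
      · exact h'.2 (hyt ▸ hKS)
    · have h' := hin (T - t) ⟨by linarith, by linarith⟩
      have e' : compatiblePoint d n + (T - t) • dir = y n := by
        rw [sub_smul]; linear_combination -e
      exact (e' ▸ h').2 hKS
  · subst h; simpa using e
  -- The other candidate would lie behind the compatible point, but going backward from there leaves
  -- the table at once.
  · exfalso
    obtain ⟨a, b, u, v, he, hE, rfl, hv⟩ := compatibleEdge_spec d n
    obtain ⟨hX, hY⟩ := compatiblePoint_coord he
    have h1 := eventually_notMem_table hE (h01 n).1 (h01 n).2 hX hY (g := 0) (h := -1) (by norm_num)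
    have h2 : ∀ᶠ r : ℝ in 𝓝[>] 0, r < t - T :=
      nhdsWithin_le_nhds (eventually_lt_nhds (by linarith))
    obtain ⟨r, ⟨h1, h2⟩, h3⟩ := ((h1.and h2).and self_mem_nhdsWithin).exists
    have h3 : 0 < r := h3
    apply h1
    have h4 := (hyin (t - T - r) ⟨by linarith, by linarith⟩).1
    have e' : pt (0 : ℤ) (-1 : ℤ) = -dir := by simp [pt]
    rw [e', smul_neg]
    convert h4 using 1
    rw [sub_smul, sub_smul]
    linear_combination -e

theorem compatiblePoint_eq_of_ne_one {d : ℕ → Fin 3} {N : ℕ} (h : ∀ i, d (i + N) ≠ 1) (k : ℕ) :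
    compatiblePoint d (N + k) = compatiblePoint d N := by
  induction k with
  | zero => rfl
  | succ k ih =>
    rw [← add_assoc, compatiblePoint_succ_of_ne_one (by rw [add_comm]; exact h k), ih]

end KochBilliard

end

/-! ### Stabilization of the compatible orbits -/

theorem mainTheorem10 (d : ℕ → Fin 3)
    (hc : {i | d i = 1}.Finite) (hl : {i | d i = 0}.Infinite) (hr : {i | d i = 2}.Infinite)
    (N : ℕ) (hN : IsLeast {m : ℕ | ∀ i, (leftShift^[m] d) i ≠ 1} N) :
    ∃ x : ℕ → ℂ,
      IsCompatibleSeq dir ((Real.ofDigits d : ℝ) : ℂ) x ∧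
      (∀ y : ℕ → ℂ, IsCompatibleSeq dir ((Real.ofDigits d : ℝ) : ℂ) y → y = x) ∧
      (∀ n, IsPeriodic n (x n, dir)) ∧
      (∀ n, N ≤ n → orbit n (x n, dir) = orbit N (x N, dir)) ∧
      (∀ m, m < N → footprint m (x m, dir) ≠ footprint N (x N, dir)) ∧
      (∀ n, N ≤ n → ∃ s ∈ sides n,
        x n = s.1 + Real.ofDigits (leftShift^[n] d) • (s.2 - s.1)) := by
  have h0 : ∀ n, ∃ i, d (i + n) = 0 := fun n => by
    obtain ⟨j, hj, hnj⟩ := hl.exists_gt n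
    exact ⟨j - n, by rwa [Nat.sub_add_cancel hnj.le]⟩
  have h2 : ∀ n, ∃ i, d (i + n) = 2 := fun n => by
    obtain ⟨j, hj, hnj⟩ := hr.exists_gt n
    exact ⟨j - n, by rwa [Nat.sub_add_cancel hnj.le]⟩
  have h01 : ∀ n, 0 < Real.ofDigits (leftShift^[n] d) ∧ Real.ofDigits (leftShift^[n] d) < 1 := by
    intro n
    obtain ⟨i, hi⟩ := h0 n
    obtain ⟨j, hj⟩ := h2 n
    refine ⟨ofDigits_pos (i := j) ?_, ofDigits_lt_one (i := i) ?_⟩ <;> rw [leftShift_iterate]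
    · rw [hj]; decide
    · rw [hi]; decide
  have hN1 : ∀ i, d (i + N) ≠ 1 := fun i => by
    have := (hN.1 : ∀ i, _) i
    rwa [leftShift_iterate] at this
  refine ⟨compatiblePoint d, isCompatibleSeq_compatiblePoint h01,
    fun y hy => hy.eq_compatiblePoint h01,
    fun n => (latticePhase_compatiblePoint d n).isPeriodic (h01 n).1 (h01 n).2, ?_, ?_, ?_⟩
  · intro n hn
    obtain ⟨k, rfl⟩ := Nat.exists_eq_add_of_le hn
    rw [compatiblePoint_eq_of_ne_one hN1]
    refine orbit_persist (e := leftShift^[N] d) hN.1 ?_ ?_ (latticePhase_compatiblePoint d N) k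
    · intro k
      obtain ⟨i, hi⟩ := h0 (k + N)
      exact ⟨i, by rw [leftShift_iterate, add_assoc, hi]⟩
    · intro k
      obtain ⟨i, hi⟩ := h2 (k + N)
      exact ⟨i, by rw [leftShift_iterate, add_assoc, hi]⟩
  · intro m hm heq
    have hm' : ¬ ∀ i, (leftShift^[m] d) i ≠ 1 := fun h => (hN.2 h).not_gt hm
    push Not at hm'
    obtain ⟨i, hi⟩ := hm'
    rw [leftShift_iterate] at hi
    have hiN : i + m < N := by
      by_contra hge
      refine hN1 (i + m - N) ?_
      rwa [Nat.sub_add_cancel (not_lt.1 hge)]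
    -- The digit `c` at position `i + m` makes the level `m` basepoint interior from level `i + m +
    -- 1 ≤ N` on, while the footprint at level `N` lies on the curve.
    have hin : compatiblePoint d m ∈ inside (i + m + 1) := by
      obtain ⟨T, -, hx, -, hor⟩ := compatiblePoint_ray h01 (Nat.le_add_left m i)
      rcases hor with rfl | h
      · rw [hx, zero_smul, add_zero]
        exact compatiblePoint_mem_inside hi (h01 _).1 (h01 _).2
      · exact inside_mono (Nat.le_succ _) h
    have hmem : compatiblePoint d m ∈ footprint m (compatiblePoint d m, dir) := ⟨0, dir, rfl⟩
    rw [heq] at hmem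
    obtain ⟨k, v, hk⟩ := hmem
    obtain ⟨q, hq, hq'⟩ := (latticePhase_compatiblePoint d N).orbit (h01 N).1 (h01 N).2 k
    rw [hk, Option.some_inj] at hq
    subst hq
    exact (inside_mono hiN hin).2 (hq'.mem_KS (h01 N).1 (h01 N).2)
  · intro n _
    obtain ⟨a, b, u, v, he, hE, -⟩ := compatibleEdge_spec d n
    exact ⟨compatibleSide d n, mem_sides.2 ⟨a, b, u, v, hE, by rw [compatibleSide, he]⟩, rfl⟩
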